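/- **Setting.** Let $m\in\mathbb N$ and consider the double-integrator model $$A=\begin{pmatrix}0&I_m\\0&0\end{pmatrix}\in\mathbb R^{2m\times 2m},\qquad B=\begin{pmatrix}0\\I_m\end{pmatrix}\in\mathbb R^{2m\times m},\qquad C=I_{2m}.$$ A network consists of $N$ agents and an exosystem, $$\dot x_i=Ax_i+B\sigma(u_i),\quad y_i=Cx_i\quad(i=1,\dots,N),\qquad \dot x_r=Ax_r,\quad y_r=Cx_r,$$ where $\sigma$ is the componentwise saturation $\mathrm{sat}(w)=\mathrm{sgn}(w)\min(1,|w|)$. The communication graph is a weighted directed graph with adjacency matrix $[a_{ij}]$, $a_{ij}\ge 0$, $a_{ii}=0$, where $a_{ij}>0$ means that there is an edge from $j$ to $i$. Let $\mathscr C\subseteq\{1,\dots,N\}$ be a nonempty set of nodes, with $\iota_i=1$ for $i\in\mathscr C$ and $\iota_i=0$ otherwise. Let $\mathbb G^N_{\mathscr C}$ be the set of such graphs in which every node belongs to a directed tree (a subgraph with a root that has no parent, in which every other node has exactly one parent and is reached from the root by a directed path) whose root lies in $\mathscr C$. Agent $i$ receives $$\bar\zeta_i=\sum_{j=1}^N a_{ij}(y_i-y_j)+\iota_i(y_i-y_r)\qquad\text{and}\qquad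 \hat\zeta_i=\sum_{j=1}^N a_{ij}(\xi_i-\xi_j),$$ where $\xi_i\in\mathbb R^{2m}$ is a variable produced by the protocol of agent $i$. The protocols are of the linear form $$\dot x_{c,i}=A_c(\iota_i)x_{c,i}+B_c\sigma(u_i)+C_c\bar\zeta_i+D_c\hat\zeta_i,\qquad u_i=F_cx_{c,i},\qquad \xi_i=H_cx_{c,i},$$ with matrices that are the same for all agents, except that $A_c$ may depend on $\iota_i\in\{0,1\}$. A protocol *solves the scalable global regulated state synchronization problem* if for every $N$, every nonempty $\mathscr C$, every graph in $\mathbb G^N_{\mathscr C}$ and all initial conditions $x_r(0)$, $x_i(0)$, $x_{c,i}(0)$, the closed loop has a solution on $[0,\infty)$ and every such solution satisfies $\lim_{t\to\infty}(x_i(t)-x_r(t))=0$ for all $i$ and $\lim_{t\to\infty}(x_i(t)-x_j(t))=0$ for all $i,j$. **Theorem.** The scalable global regulated state synchronization problem is solvable for double-integrator agents with full-state coupling $C=I$: there is one protocol of the above form, chosen from $(A,B,C)$ alone, that solves it. In particular, for every $\rho>0$ and all symmetric negative definite $K_1,K_2\in\mathbb R^{m\times m}$, with $K=\begin{pmatrix}K_1&K_2\end{pmatrix}$,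 the protocol $$\dot\chi_i=A\chi_i+B\sigma(u_i)+\bar\zeta_i-\hat\zeta_i-\iota_i\chi_i,\qquad u_i=\rho K\chi_i,\qquad \xi_i=\chi_i,$$ solves it. -/

import Mathlib

open Filter Topology

noncomputable section

namespace MAS

/-- The standard scalar saturation function. -/
def sat (w : ℝ) : ℝ := Real.sign w * min 1 |w|

/-- The componentwise saturation of a vector. -/
def satVec {m : Type} (v : m → ℝ) : m → ℝ := fun k => sat (v k)

/-- A weighted directed graph on `N` nodes, given by its adjacency matrix. A positive entry
`adj i j` is the weight of an edge from node `j` to node `i`. There are no self-loops. -/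
structure WeightedGraph (N : ℕ) where
  adj : Matrix (Fin N) (Fin N) ℝ
  nonneg : ∀ i j, 0 ≤ adj i j
  no_loop : ∀ i, adj i i = 0

namespace WeightedGraph

variable {N : ℕ}

/-- `G.Edge j i` : there is an edge from node `j` to node `i`. -/
def Edge (G : WeightedGraph N) (j i : Fin N) : Prop := 0 < G.adj i j

/-- The subgraph of `G` with node set `W` and edges `T` (`T j i` is an edge from `j` to `i`) is a
directed tree with root `r`: the root has no parent, every other node of `W` has exactly one
parent, and every node of `W` is reached from `r` by a directed path of the subgraph. -/
structure IsDirectedTree (G : WeightedGraph N) (W : Set (Fin N)) (T : Fin N → Fin N → Prop)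
    (r : Fin N) : Prop where
  edge_of : ∀ j i, T j i → G.Edge j i
  mem_of : ∀ j i, T j i → j ∈ W ∧ i ∈ W
  root_mem : r ∈ W
  root_no_parent : ∀ j, ¬ T j r
  unique_parent : ∀ i ∈ W, i ≠ r → ∃! j, T j i
  reachable : ∀ i ∈ W, Relation.ReflTransGen T r i

/-- The class of graphs in which every node is a member of a directed tree whose root lies in
the root set `R`. -/
def InClass (G : WeightedGraph N) (R : Finset (Fin N)) : Prop :=
  ∀ i : Fin N, ∃ (W : Set (Fin N)) (T : Fin N → Fin N → Prop) (r : Fin N),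
    G.IsDirectedTree W T r ∧ r ∈ R ∧ i ∈ W

/-- The Laplacian matrix of the graph. -/
def laplacian (G : WeightedGraph N) : Matrix (Fin N) (Fin N) ℝ :=
  fun i j => if i = j then ∑ k, G.adj i k else - G.adj i j

end WeightedGraph

/-- The indicator `ι_i` of the agents that have access to the exosystem. -/
def iota {N : ℕ} (R : Finset (Fin N)) (i : Fin N) : ℝ := if i ∈ R then 1 else 0

/-- The expanded Laplacian `L + diag ι`. -/
def expandedLaplacian {N : ℕ} (G : WeightedGraph N) (R : Finset (Fin N)) :
    Matrix (Fin N) (Fin N) ℝ := G.laplacian + Matrix.diagonal (iota R)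

/-- The relative information `∑ j, a_ij (z_i - z_j)`. -/
def diffusive {N : ℕ} {k : Type} (G : WeightedGraph N) (z : Fin N → k → ℝ) (i : Fin N) : k → ℝ :=
  ∑ j, G.adj i j • (z i - z j)

/-- The network exchange `∑ j, a_ij (y_i - y_j) + ι_i (y_i - y_r)`. -/
def networkExchange {N : ℕ} {q : Type} (G : WeightedGraph N) (R : Finset (Fin N))
    (y : Fin N → q → ℝ) (yr : q → ℝ) (i : Fin N) : q → ℝ :=
  diffusive G y i + iota R i • (y i - yr)

lemma diffusive_eq_laplacian {N : ℕ} {k : Type} (G : WeightedGraph N) (z : Fin N → k → ℝ)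
    (i : Fin N) : diffusive G z i = ∑ j, G.laplacian i j • z j := by
  have h : ∀ j, G.laplacian i j • z j
      = (if i = j then (∑ k, G.adj i k) • z j else 0) - G.adj i j • z j := by
    intro j
    by_cases hij : i = j
    · subst hij
      simp [WeightedGraph.laplacian, G.no_loop]
    · simp [WeightedGraph.laplacian, hij]
  simp only [h, diffusive, smul_sub, Finset.sum_sub_distrib, Finset.sum_ite_eq,
    Finset.mem_univ, if_true, Finset.sum_smul]

/-- The network exchange in terms of the expanded Laplacian: `∑ j, ℓ̄_ij (y_j - y_r)`. -/
lemma networkExchange_eq {N : ℕ} {q : Type} (G : WeightedGraph N) (R : Finset (Fin N))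
    (y : Fin N → q → ℝ) (yr : q → ℝ) (i : Fin N) :
    networkExchange G R y yr i = ∑ j, expandedLaplacian G R i j • (y j - yr) := by
  have h1 : diffusive G y i = diffusive G (fun j => y j - yr) i := by
    simp [diffusive]
  rw [networkExchange, h1, diffusive_eq_laplacian]
  simp [expandedLaplacian, Matrix.add_apply, add_smul, Finset.sum_add_distrib,
    Matrix.diagonal_apply, ite_smul]

/-- A linear dynamic protocol with state in `ℝ^c`, for agents with state in `ℝ^n`, input in `ℝ^m`
and output in `ℝ^q`:
`x_c' = A_c x_c + B_c σ(u) + C_c ζ̄ + D_c ζ̂`, `u = F_c x_c`, `ξ = H_c x_c`.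
The same matrices serve all agents, except that the state matrix `A_c` may take two values,
according to whether the agent has access to the exosystem (`ι_i = 1`) or not (`ι_i = 0`). -/
structure LinearProtocol (n m q c : Type) where
  Ac : ℝ → Matrix c c ℝ
  Bc : Matrix c m ℝ
  Cc : Matrix c q ℝ
  Dc : Matrix c n ℝ
  Fc : Matrix m c ℝ
  Hc : Matrix n c ℝ

section Problem

variable {n m q c : Type} [Fintype n] [Fintype m] [Fintype q] [Fintype c]

/-- `(xr, x, xc)` is a solution on `[0, ∞)` of the closed loop of the exosystem, the agents and
the protocol `P` over the network `G` with root set `R` (the derivative at `0` is one-sided). -/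
structure IsClosedLoopSolution (A : Matrix n n ℝ) (B : Matrix n m ℝ) (C : Matrix q n ℝ)
    (P : LinearProtocol n m q c) {N : ℕ} (G : WeightedGraph N) (R : Finset (Fin N))
    (xr : ℝ → n → ℝ) (x : ℝ → Fin N → n → ℝ) (xc : ℝ → Fin N → c → ℝ) : Prop where
  exosystem : ∀ t : ℝ, 0 ≤ t → HasDerivWithinAt xr (A.mulVec (xr t)) (Set.Ici 0) t
  agent : ∀ i, ∀ t : ℝ, 0 ≤ t →
    HasDerivWithinAt (fun s => x s i)
      (A.mulVec (x t i) + B.mulVec (satVec (P.Fc.mulVec (xc t i)))) (Set.Ici 0) t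
  protocol : ∀ i, ∀ t : ℝ, 0 ≤ t →
    HasDerivWithinAt (fun s => xc s i)
      ((P.Ac (iota R i)).mulVec (xc t i)
        + P.Bc.mulVec (satVec (P.Fc.mulVec (xc t i)))
        + P.Cc.mulVec (networkExchange G R (fun j => C.mulVec (x t j)) (C.mulVec (xr t)) i)
        + P.Dc.mulVec (diffusive G (fun j => P.Hc.mulVec (xc t j)) i)) (Set.Ici 0) t

/-- The agents synchronize with the exosystem trajectory, and hence with each other. -/
def RegulatedStateSync {N : ℕ} (xr : ℝ → n → ℝ) (x : ℝ → Fin N → n → ℝ) : Prop :=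
  (∀ i, Tendsto (fun t => x t i - xr t) atTop (𝓝 0)) ∧
  (∀ i j, Tendsto (fun t => x t i - x t j) atTop (𝓝 0))

/-- The protocol `P` solves the scalable global regulated state synchronization problem for the
agent model `(A, B, C)`: for every number of agents, every nonempty root set, every graph of the
associated class and all initial conditions, the closed loop has a solution on `[0, ∞)`, and
regulated state synchronization holds along every such solution. -/
def SolvesScalableSync (A : Matrix n n ℝ) (B : Matrix n m ℝ) (C : Matrix q n ℝ)
    (P : LinearProtocol n m q c) : Prop :=
  ∀ (N : ℕ) (R : Finset (Fin N)), R.Nonempty → ∀ G : WeightedGraph N, G.InClass R →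
    ∀ (xr₀ : n → ℝ) (x₀ : Fin N → n → ℝ) (xc₀ : Fin N → c → ℝ),
      (∃ xr x xc, IsClosedLoopSolution A B C P G R xr x xc ∧
        xr 0 = xr₀ ∧ x 0 = x₀ ∧ xc 0 = xc₀) ∧
      (∀ xr x xc, IsClosedLoopSolution A B C P G R xr x xc →
        xr 0 = xr₀ → x 0 = x₀ → xc 0 = xc₀ → RegulatedStateSync xr x)

/-- The scalable problem is solvable for the agent model `(A, B, C)`: one protocol, chosen from
the agent model only, works for all networks. -/
def ScalableSyncSolvable (A : Matrix n n ℝ) (B : Matrix n m ℝ) (C : Matrix q n ℝ) : Prop :=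
  ∃ (c : Type) (_ : Fintype c) (P : LinearProtocol n m q c), SolvesScalableSync A B C P

end Problem

/-- The state matrix `[0 I; 0 0]` of the double integrator on `ℝ^m × ℝ^m`. -/
def doubleIntegratorA (m : ℕ) : Matrix (Fin m ⊕ Fin m) (Fin m ⊕ Fin m) ℝ :=
  Matrix.fromBlocks 0 1 0 0

/-- The input matrix `[0; I]` of the double integrator. -/
def doubleIntegratorB (m : ℕ) : Matrix (Fin m ⊕ Fin m) (Fin m) ℝ :=
  Matrix.fromRows 0 1

/-- The protocol `χ' = A χ + B σ(u) + ζ̄ - ζ̂ - ι χ`, `u = ρ K χ`, `ξ = χ`. -/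
def fullStateProtocol {n m : Type} [DecidableEq n] (A : Matrix n n ℝ) (B : Matrix n m ℝ)
    (K : Matrix m n ℝ) (ρ : ℝ) : LinearProtocol n m n n where
  Ac := fun s => A - s • (1 : Matrix n n ℝ)
  Bc := B
  Cc := 1
  Dc := -1
  Fc := ρ • K
  Hc := 1

/-- The closed loop of `fullStateProtocol` under full-state coupling, written out. -/
lemma isClosedLoopSolution_fullStateProtocol_iff {n m : Type} [Fintype n] [DecidableEq n]
    [Fintype m] (A : Matrix n n ℝ) (B : Matrix n m ℝ) (K : Matrix m n ℝ) (ρ : ℝ) {N : ℕ}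
    (G : WeightedGraph N) (R : Finset (Fin N))
    (xr : ℝ → n → ℝ) (x χ : ℝ → Fin N → n → ℝ) :
    IsClosedLoopSolution A B 1 (fullStateProtocol A B K ρ) G R xr x χ ↔
      (∀ t : ℝ, 0 ≤ t → HasDerivWithinAt xr (A.mulVec (xr t)) (Set.Ici 0) t) ∧
      (∀ i, ∀ t : ℝ, 0 ≤ t → HasDerivWithinAt (fun s => x s i)
        (A.mulVec (x t i) + B.mulVec (satVec (ρ • K.mulVec (χ t i)))) (Set.Ici 0) t) ∧
      (∀ i, ∀ t : ℝ, 0 ≤ t → HasDerivWithinAt (fun s => χ s i)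
        (A.mulVec (χ t i) + B.mulVec (satVec (ρ • K.mulVec (χ t i)))
          + networkExchange G R (x t) (xr t) i - diffusive G (χ t) i
          - iota R i • χ t i) (Set.Ici 0) t) := by
  have key : ∀ i t,
      ((fullStateProtocol A B K ρ).Ac (iota R i)).mulVec (χ t i)
        + (fullStateProtocol A B K ρ).Bc.mulVec
            (satVec ((fullStateProtocol A B K ρ).Fc.mulVec (χ t i)))
        + (fullStateProtocol A B K ρ).Cc.mulVec
            (networkExchange G R (fun j => (1 : Matrix n n ℝ).mulVec (x t j))
              ((1 : Matrix n n ℝ).mulVec (xr t)) i)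
        + (fullStateProtocol A B K ρ).Dc.mulVec
            (diffusive G (fun j => (fullStateProtocol A B K ρ).Hc.mulVec (χ t j)) i)
      = A.mulVec (χ t i) + B.mulVec (satVec (ρ • K.mulVec (χ t i)))
          + networkExchange G R (x t) (xr t) i - diffusive G (χ t) i
          - iota R i • χ t i := by
    intro i t
    simp only [fullStateProtocol, Matrix.sub_mulVec, Matrix.smul_mulVec, Matrix.one_mulVec,
      Matrix.neg_mulVec]
    abel
  constructor
  · rintro ⟨h1, h2, h3⟩
    refine ⟨h1, fun i t ht => ?_, fun i t ht => ?_⟩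
    · simpa only [fullStateProtocol, Matrix.smul_mulVec] using h2 i t ht
    · rw [← key i t]
      exact h3 i t ht
  · rintro ⟨h1, h2, h3⟩
    refine ⟨h1, fun i t ht => ?_, fun i t ht => ?_⟩
    · simpa only [fullStateProtocol, Matrix.smul_mulVec] using h2 i t ht
    · rw [key i t]
      exact h3 i t ht

end MAS

end

/-!
The estimation errors `e_i = x_i - x_r - χ_i` obey a linear equation, because the saturated inputs
of agent and protocol cancel: `e_i' = A e_i - ∑ j, ℓ_ij e_j`, where `ℓ` is the expanded Laplacian
(`hasDerivWithinAt_estimationError`). Reachability of every node from the root set makes `ℓ` a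
nonsingular M-matrix: it maps some positive vector to a positive vector
(`exists_pos_expandedLaplacian`). In the supremum norm weighted by that vector Grönwall's inequality
gives exponential decay of the errors (`exists_exp_decay`); no spectral theory is needed.

Relative to the exosystem, each agent is then a double integrator `p' = v`,
`v' = -sat (P p + Q v - w)` with `P`, `Q` positive definite and `w` exponentially decaying. A
Lyapunov function built from `∑ k, ∫ sat` of the feedback signal and the kinetic term `v ⬝ P v / 2`,
corrected by an exponential factor that absorbs `w`, together with a form of Barbalat's lemma
(`tendsto_zero_of_dissipation`), shows that `P p + Q v` tends to zero
(`saturated_feedback_tendsto_zero`). The remaining motion `Q p' = -P p + o(1)` is exponentially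
stable with a vanishing input, so `p` and `v` tend to zero (`tendsto_zero_of_combination`).

Solutions exist for all time because the closed loop is globally Lipschitz
(`exists_global_solution`, `exists_isClosedLoopSolution`).
-/

namespace MAS

/-! ### Global solutions of Lipschitz autonomous equations -/

section GlobalExistence

variable {E : Type*} [NormedAddCommGroup E] [NormedSpace ℝ E]

/-- A solution on `[0, T]` and a solution on `[T, S]` that meet at `T` concatenate. -/
lemma exists_solution_concat {f : E → E} {T S : ℝ} (hT : 0 ≤ T) (hS : T ≤ S) {a b : ℝ → E}
    (ha : ∀ t ∈ Set.Icc 0 T, HasDerivWithinAt a (f (a t)) (Set.Icc 0 T) t)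
    (hb : ∀ t ∈ Set.Icc T S, HasDerivWithinAt b (f (b t)) (Set.Icc T S) t) (hab : b T = a T) :
    ∃ c : ℝ → E, c 0 = a 0 ∧
      ∀ t ∈ Set.Icc 0 S, HasDerivWithinAt c (f (c t)) (Set.Icc 0 S) t := by
  classical
  set c : ℝ → E := fun t => if t ≤ T then a t else b t with hc
  have hca : ∀ t, t ≤ T → c t = a t := fun t ht => by simp [hc, ht]
  have hcb : ∀ t, T ≤ t → c t = b t := by
    intro t ht
    rcases ht.eq_or_lt with rfl | h
    · simp [hc, hab]
    · simp [hc, h.not_ge]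
  have hleft : ∀ t ∈ Set.Icc 0 T, HasDerivWithinAt c (f (c t)) (Set.Icc 0 T) t := by
    intro t ht
    rw [hca t ht.2]
    exact (ha t ht).congr (fun s hs => hca s hs.2) (hca t ht.2)
  have hright : ∀ t ∈ Set.Icc T S, HasDerivWithinAt c (f (c t)) (Set.Icc T S) t := by
    intro t ht
    rw [hcb t ht.1]
    exact (hb t ht).congr (fun s hs => hcb s hs.1) (hcb t ht.1)
  refine ⟨c, hca 0 hT, fun t ht => ?_⟩
  rcases lt_trichotomy t T with h | rfl | h
  · refine (hleft t ⟨ht.1, h.le⟩).mono_of_mem_nhdsWithin ?_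
    exact mem_nhdsWithin.2 ⟨Set.Iio T, isOpen_Iio, h, fun s hs => ⟨hs.2.1, (le_of_lt hs.1)⟩⟩
  · have := (hleft t ⟨ht.1, le_rfl⟩).union (hright t ⟨le_rfl, ht.2⟩)
    rwa [Set.Icc_union_Icc_eq_Icc ht.1 ht.2] at this
  · refine (hright t ⟨h.le, ht.2⟩).mono_of_mem_nhdsWithin ?_
    exact mem_nhdsWithin.2 ⟨Set.Ioi T, isOpen_Ioi, h, fun s hs => ⟨le_of_lt hs.1, hs.2.2⟩⟩

variable [CompleteSpace E]

open scoped NNReal in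
/-- The time step `1 / (2 (K + 1))` of the local solution does not depend on the initial value. -/
lemma exists_local_solution {f : E → E} {K : ℝ≥0} (hf : LipschitzWith K f) (T : ℝ) (x₀ : E) :
    ∃ b : ℝ → E, b T = x₀ ∧ ∀ t ∈ Set.Icc T (T + 1 / (2 * ((K : ℝ) + 1))),
      HasDerivWithinAt b (f (b t)) (Set.Icc T (T + 1 / (2 * ((K : ℝ) + 1)))) t := by
  set h : ℝ := 1 / (2 * ((K : ℝ) + 1)) with hh
  have hK : (0 : ℝ) ≤ K := K.2
  have hpos : 0 < h := by positivity
  set a : ℝ≥0 := ‖f x₀‖₊ with ha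
  have hPL : IsPicardLindelof (fun _ => f) (tmin := T) (tmax := T + h)
      ⟨T, le_rfl, by linarith⟩ x₀ a 0 (a + K * a) K := by
    refine IsPicardLindelof.of_time_independent ?_ (hf.lipschitzOnWith) ?_
    · intro x hx
      have h1 : ‖f x - f x₀‖ ≤ K * ‖x - x₀‖ := hf.norm_sub_le x x₀
      have h2 : ‖x - x₀‖ ≤ a := by simpa [dist_eq_norm] using hx
      have h3 : ‖f x‖ ≤ ‖f x₀‖ + ‖f x - f x₀‖ := by
        simpa using norm_add_le (f x₀) (f x - f x₀)
      have h4 : (K : ℝ) * ‖x - x₀‖ ≤ K * a := by gcongr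
      push_cast
      have h5 : (a : ℝ) = ‖f x₀‖ := by simp [ha]
      linarith
    · have h0 : (0 : ℝ) ≤ a := a.2
      have h1 : ((K : ℝ) + 1) * h = 1 / 2 := by rw [hh]; field_simp
      simp only [add_sub_cancel_left, sub_self, max_eq_left hpos.le]
      push_cast
      have : ((a : ℝ) + K * a) * h = a * (((K : ℝ) + 1) * h) := by ring
      rw [this, h1]
      linarith
  exact hPL.exists_eq_forall_mem_Icc_hasDerivWithinAt₀

open scoped NNReal in
/-- An autonomous equation with a globally Lipschitz right-hand side has a solution on `[0, ∞)`
from every initial value. -/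
theorem exists_global_solution {f : E → E} {K : ℝ≥0} (hf : LipschitzWith K f) (x₀ : E) :
    ∃ γ : ℝ → E, γ 0 = x₀ ∧ ∀ t, 0 ≤ t → HasDerivWithinAt γ (f (γ t)) (Set.Ici 0) t := by
  set h : ℝ := 1 / (2 * ((K : ℝ) + 1)) with hh
  have hK : (0 : ℝ) ≤ K := K.2
  have hpos : 0 < h := by positivity
  have step : ∀ n : ℕ, ∃ γ : ℝ → E, γ 0 = x₀ ∧
      ∀ t ∈ Set.Icc 0 (n * h), HasDerivWithinAt γ (f (γ t)) (Set.Icc 0 (n * h)) t := by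
    intro n
    induction n with
    | zero =>
      refine ⟨fun _ => x₀, rfl, fun t ht => ?_⟩
      simp only [Nat.cast_zero, zero_mul, Set.Icc_self, Set.mem_singleton_iff] at ht ⊢
      subst ht
      exact hasDerivWithinAt_iff_hasFDerivWithinAt.2 HasFDerivWithinAt.singleton
    | succ n ih =>
      obtain ⟨γ, h0, hγ⟩ := ih
      obtain ⟨b, hb0, hb⟩ := exists_local_solution hf (n * h) (γ (n * h))
      obtain ⟨c, hc0, hc⟩ := exists_solution_concat (by positivity) (by linarith) hγ hb hb0
      refine ⟨c, hc0.trans h0, ?_⟩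
      have : ((n + 1 : ℕ) : ℝ) * h = n * h + h := by push_cast; ring
      rw [this]
      exact hc
  choose γ h0 hγ using step
  have agree : ∀ n k : ℕ, n ≤ k → ∀ t ∈ Set.Icc 0 (n * h), γ n t = γ k t := by
    intro n k hnk
    have hsub : (n : ℝ) * h ≤ k * h := by gcongr
    have toRight : ∀ l : ℕ, n ≤ l → ∀ t ∈ Set.Ico 0 ((n : ℝ) * h),
        HasDerivWithinAt (γ l) (f (γ l t)) (Set.Ici t) t := by
      intro l hl t ht
      have hsub : (n : ℝ) * h ≤ l * h := by gcongr
      refine (hγ l t ⟨ht.1, (ht.2.le.trans hsub)⟩).mono_of_mem_nhdsWithin ?_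
      exact mem_nhdsWithin.2 ⟨Set.Iio (l * h), isOpen_Iio, ht.2.trans_le hsub,
        fun s hs => ⟨ht.1.trans hs.2, le_of_lt hs.1⟩⟩
    exact ODE_solution_unique_of_mem_Icc_right (v := fun _ => f) (s := fun _ => Set.univ) (K := K)
      (fun _ _ => hf.lipschitzOnWith)
      (fun t ht => (hγ n t ht).continuousWithinAt) (toRight n le_rfl) (fun _ _ => trivial)
      (fun t ht => ((hγ k t ⟨ht.1, ht.2.trans hsub⟩).continuousWithinAt).mono
        (Set.Icc_subset_Icc_right hsub)) (toRight k hnk) (fun _ _ => trivial)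
      ((h0 n).trans (h0 k).symm)
  have glue : ∀ n : ℕ, ∀ t ∈ Set.Icc 0 ((n : ℝ) * h), γ ⌈t / h⌉₊ t = γ n t := by
    intro n t ht
    refine agree _ n (Nat.ceil_le.2 ((div_le_iff₀ hpos).2 ht.2)) t ⟨ht.1, ?_⟩
    exact (div_le_iff₀ hpos).1 (Nat.le_ceil _)
  refine ⟨fun t => γ ⌈t / h⌉₊ t, by simp [h0], fun t ht => ?_⟩
  -- A horizon strictly beyond `t`, so that `[0, n h]` is a neighbourhood of `t` in `[0, ∞)`.
  obtain ⟨n, hn⟩ := exists_nat_gt (t / h)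
  have hn' : t < n * h := (div_lt_iff₀ hpos).1 hn
  have hmem : t ∈ Set.Icc 0 ((n : ℝ) * h) := ⟨ht, hn'.le⟩
  have := (hγ n t hmem).congr (f₁ := fun t => γ ⌈t / h⌉₊ t) (glue n) (glue n t hmem)
  rw [← glue n t hmem] at this
  refine this.mono_of_mem_nhdsWithin ?_
  exact mem_nhdsWithin.2 ⟨Set.Iio (n * h), isOpen_Iio, hn', fun s hs => ⟨hs.2, le_of_lt hs.1⟩⟩

end GlobalExistence

/-! ### The expanded Laplacian as a nonsingular M-matrix -/

section Laplacian

variable {N : ℕ} {G : WeightedGraph N} {R : Finset (Fin N)}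

/-- In a graph of the class, nodes carry a depth that vanishes only on the root set and that is
smaller at some parent of every other node. -/
lemma exists_depth (hG : G.InClass R) :
    ∃ k : Fin N → ℕ, ∀ i, i ∈ R ∨ ∃ j, G.Edge j i ∧ k j < k i := by
  classical
  -- `D n i` says that a directed walk of length `n` leads from the root set to `i`.
  let D : ℕ → Fin N → Prop := fun n => Nat.rec (motive := fun _ => Fin N → Prop) (fun i => i ∈ R)
    (fun _ P i => ∃ j, P j ∧ G.Edge j i) n
  have hD : ∀ i, ∃ n, D n i := by
    intro i
    obtain ⟨W, T, r, hT, hr, hi⟩ := hG i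
    have h := hT.reachable i hi
    induction h with
    | refl => exact ⟨0, hr⟩
    | tail _ hbc ih =>
      obtain ⟨n, hn⟩ := ih (hT.mem_of _ _ hbc).1
      exact ⟨n + 1, _, hn, hT.edge_of _ _ hbc⟩
  refine ⟨fun i => Nat.find (hD i), fun i => ?_⟩
  have hspec := Nat.find_spec (hD i)
  rcases hn : Nat.find (hD i) with _ | n
  · left
    rw [hn] at hspec
    exact hspec
  · right
    rw [hn] at hspec
    obtain ⟨j, hj, hji⟩ := hspec
    exact ⟨j, hji, lt_of_le_of_lt (Nat.find_min' (hD j) hj) (by simp only [hn]; omega)⟩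

lemma expandedLaplacian_mulVec_apply (G : WeightedGraph N) (R : Finset (Fin N)) (d : Fin N → ℝ)
    (i : Fin N) :
    ∑ j, expandedLaplacian G R i j * d j = ∑ j, G.adj i j * (d i - d j) + iota R i * d i := by
  have h := congrFun (networkExchange_eq (q := Unit) G R (fun j _ => d j) 0 i) ()
  simp only [networkExchange, diffusive, Pi.add_apply, Finset.sum_apply, Pi.smul_apply,
    Pi.sub_apply, smul_eq_mul, sub_zero] at h
  exact h.symm

lemma expandedLaplacian_offDiag_nonpos (G : WeightedGraph N) (R : Finset (Fin N)) {i j : Fin N}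
    (h : i ≠ j) : expandedLaplacian G R i j ≤ 0 := by
  simp [expandedLaplacian, WeightedGraph.laplacian, h, G.nonneg]

/-- The expanded Laplacian maps some positive vector `d` to a positive vector: the vector
`d i = 1 - ε ^ (k i + 1)`, where `k` is the depth, serves for small `ε`. -/
theorem exists_pos_expandedLaplacian (hG : G.InClass R) :
    ∃ d : Fin N → ℝ, ∃ μ : ℝ, 0 < μ ∧ (∀ i, 0 < d i) ∧
      ∀ i, μ * d i ≤ ∑ j, expandedLaplacian G R i j * d j := by
  obtain ⟨k, hk⟩ := exists_depth hG
  have key : ∀ i, ∀ᶠ ε : ℝ in 𝓝[>] 0,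
      0 < ∑ j, expandedLaplacian G R i j * (1 - ε ^ (k j + 1)) := by
    intro i
    have hsmall : ∀ b c : ℝ, 0 < c → ∀ᶠ ε : ℝ in 𝓝[>] 0, b * ε < c * (1 - ε) := by
      intro b c hc
      refine nhdsWithin_le_nhds ?_
      refine (ContinuousAt.eventually_lt (f := fun ε : ℝ => b * ε)
        (g := fun ε : ℝ => c * (1 - ε)) (by fun_prop) (by fun_prop) (by simpa using hc))
    set S := ∑ j, G.adj i j with hS
    have hS0 : 0 ≤ S := Finset.sum_nonneg fun j _ => G.nonneg i j
    have h1 : ∀ᶠ ε : ℝ in 𝓝[>] 0, ε < 1 := nhdsWithin_le_nhds (Iio_mem_nhds one_pos)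
    have hι : 0 ≤ iota R i := by unfold iota; split_ifs <;> norm_num
    have hterm : ∀ ε : ℝ, 0 < ε → ε < 1 → ∀ j,
        -(G.adj i j * ε ^ (k i + 1)) ≤ G.adj i j * ((1 - ε ^ (k i + 1)) - (1 - ε ^ (k j + 1))) := by
      intro ε h0 _ j
      have := mul_nonneg (G.nonneg i j) (pow_pos h0 (k j + 1)).le
      nlinarith
    rcases hk i with hi | ⟨p, hp, hlt⟩
    · filter_upwards [h1, hsmall S 1 one_pos, self_mem_nhdsWithin] with ε h1 h2 h0
      rw [expandedLaplacian_mulVec_apply]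
      have h3 := Finset.sum_le_sum fun j (_ : j ∈ Finset.univ) => hterm ε h0 h1 j
      rw [Finset.sum_neg_distrib, ← Finset.sum_mul, ← hS] at h3
      have h4 : ε ^ (k i + 1) ≤ ε := pow_le_of_le_one h0.le h1.le (by omega)
      have h5 : iota R i = 1 := by simp [iota, hi]
      have h6 : S * ε ^ (k i + 1) ≤ S * ε := by gcongr
      rw [h5]
      linarith
    · filter_upwards [h1, hsmall S _ hp, self_mem_nhdsWithin] with ε h1 h2 h0
      rw [expandedLaplacian_mulVec_apply]
      have hpow : 0 < ε ^ k i := pow_pos h0 _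
      have h3 : ∑ j, (-(G.adj i j * ε ^ (k i + 1)) + if j = p then G.adj i p * ε ^ k i else 0)
          ≤ ∑ j, G.adj i j * ((1 - ε ^ (k i + 1)) - (1 - ε ^ (k j + 1))) := by
        refine Finset.sum_le_sum fun j _ => ?_
        split_ifs with hj
        · subst hj
          have h4 : ε ^ k i ≤ ε ^ (k j + 1) := pow_le_pow_of_le_one h0.le h1.le hlt
          have := mul_le_mul_of_nonneg_left h4 (G.nonneg i j)
          linarith
        · simpa using hterm ε h0 h1 j
      rw [Finset.sum_add_distrib, Finset.sum_neg_distrib, ← Finset.sum_mul, ← hS,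
        Finset.sum_ite_eq' Finset.univ p] at h3
      simp only [Finset.mem_univ, if_true] at h3
      have h5 : 0 ≤ iota R i * (1 - ε ^ (k i + 1)) :=
        mul_nonneg hι (sub_nonneg.2 (pow_le_one₀ h0.le h1.le))
      have h6 := mul_lt_mul_of_pos_right h2 hpow
      have h7 : 0 ≤ G.adj i p * ε * ε ^ k i :=
        mul_nonneg (mul_nonneg (G.nonneg i p) h0.le) hpow.le
      have h8 : S * ε ^ (k i + 1) = S * ε * ε ^ k i := by ring
      rw [h8] at h3
      linarith
  obtain ⟨ε, hε, h0, h1⟩ : ∃ ε : ℝ, (∀ i, 0 < ∑ j, expandedLaplacian G R i j * (1 - ε ^ (k j + 1)))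
      ∧ 0 < ε ∧ ε < 1 := by
    have h1 : ∀ᶠ ε : ℝ in 𝓝[>] 0, ε < 1 := nhdsWithin_le_nhds (Iio_mem_nhds one_pos)
    exact ((eventually_all.2 key).and (Filter.Eventually.and self_mem_nhdsWithin h1)).exists
  obtain ⟨μ, hμ, h⟩ : ∃ μ : ℝ, (∀ i, μ * (1 - ε ^ (k i + 1)) ≤
      ∑ j, expandedLaplacian G R i j * (1 - ε ^ (k j + 1))) ∧ 0 < μ := by
    have : ∀ᶠ μ : ℝ in 𝓝[>] 0, ∀ i, μ * (1 - ε ^ (k i + 1)) ≤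
        ∑ j, expandedLaplacian G R i j * (1 - ε ^ (k j + 1)) := by
      refine eventually_all.2 fun i => nhdsWithin_le_nhds ?_
      refine (ContinuousAt.eventually_lt (f := fun μ : ℝ => μ * (1 - ε ^ (k i + 1)))
        (g := fun _ => ∑ j, expandedLaplacian G R i j * (1 - ε ^ (k j + 1)))
        (by fun_prop) (by fun_prop) (by simpa using hε i)).mono fun _ h => h.le
    exact (this.and self_mem_nhdsWithin).exists
  exact ⟨_, μ, h, fun i => sub_pos.2 (pow_lt_one₀ h0.le h1 (by omega)), hμ⟩

end Laplacian

/-! ### Exponential decay of the estimation error -/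

lemma doubleIntegratorA_mulVec_inl {m : ℕ} (x : Fin m ⊕ Fin m → ℝ) (k : Fin m) :
    (doubleIntegratorA m).mulVec x (Sum.inl k) = x (Sum.inr k) := by
  simp [doubleIntegratorA, Matrix.mulVec, dotProduct, Matrix.one_apply]

lemma doubleIntegratorA_mulVec_inr {m : ℕ} (x : Fin m ⊕ Fin m → ℝ) (k : Fin m) :
    (doubleIntegratorA m).mulVec x (Sum.inr k) = 0 := by
  simp [doubleIntegratorA, Matrix.mulVec, dotProduct]

/-- If `M` has nonpositive off-diagonal entries and `M d ≥ μ d` for a positive vector `d`, then the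
solutions of `e_i' = A e_i - ∑ j, M_ij e_j` decay exponentially. In the supremum norm weighted by
`1 / d`, the semigroup of `-M` contracts at rate `μ`; the coupling of the two blocks through the
nilpotent `A` costs only `μ / 2` of that rate once the position block is scaled by `μ / 2`. -/
theorem exists_exp_decay {N m : ℕ} {M : Matrix (Fin N) (Fin N) ℝ} {d : Fin N → ℝ} {μ : ℝ}
    (hoff : ∀ i j, i ≠ j → M i j ≤ 0) (hd : ∀ i, 0 < d i) (hμ : 0 < μ)
    (hM : ∀ i, μ * d i ≤ ∑ j, M i j * d j) {e : ℝ → Fin N → Fin m ⊕ Fin m → ℝ}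
    (he : ∀ i, ∀ t, 0 ≤ t → HasDerivWithinAt (fun s => e s i)
      ((doubleIntegratorA m).mulVec (e t i) - ∑ j, M i j • e t j) (Set.Ici 0) t) :
    ∃ C : ℝ, 0 ≤ C ∧ ∀ t, 0 ≤ t → ∀ i a, |e t i a| ≤ C * Real.exp (-(μ / 2) * t) := by
  obtain ⟨c, hc⟩ : ∃ c : ℝ, ∀ i, M i i ≤ c :=
    ⟨∑ i, |M i i|, fun i => (le_abs_self _).trans
      (Finset.single_le_sum (f := fun i => |M i i|) (fun _ _ => abs_nonneg _) (Finset.mem_univ i))⟩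
  let w : Fin m ⊕ Fin m → ℝ := Sum.elim (fun _ => μ / 2) (fun _ => 1)
  have hw : ∀ a, 0 < w a := by rintro (a | a) <;> simp [w, hμ]
  let y : ℝ → Fin N × (Fin m ⊕ Fin m) → ℝ :=
    fun t p => Real.exp (c * t) * (w p.2 / d p.1) * e t p.1 p.2
  -- The contribution of `A` after rescaling.
  let g : (Fin N × (Fin m ⊕ Fin m) → ℝ) → Fin N → Fin m ⊕ Fin m → ℝ :=
    fun z i => Sum.elim (fun k => μ / 2 * z (i, Sum.inr k)) (fun _ => 0)
  let y' : ℝ → Fin N × (Fin m ⊕ Fin m) → ℝ := fun t p =>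
    c * y t p + g (y t) p.1 p.2 - ∑ j, M p.1 j * (d j / d p.1) * y t (j, p.2)
  have hy : ∀ t, 0 ≤ t → HasDerivWithinAt y (y' t) (Set.Ici 0) t := by
    intro t ht
    rw [hasDerivWithinAt_pi]
    rintro ⟨i, a⟩
    have h1 := hasDerivWithinAt_pi.1 (he i t ht) a
    have h2 : HasDerivWithinAt (fun s : ℝ => Real.exp (c * s) * (w a / d i))
        (Real.exp (c * t) * (c * 1) * (w a / d i)) (Set.Ici 0) t :=
      ((((hasDerivAt_id t).const_mul c).exp).mul_const _).hasDerivWithinAt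
    refine (h2.mul h1).congr_deriv ?_
    have h3 : ∑ j, M i j * (d j / d i) * y t (j, a)
        = Real.exp (c * t) * (w a / d i) * ∑ j, M i j * e t j a := by
      rw [Finset.mul_sum]
      refine Finset.sum_congr rfl fun j _ => ?_
      have := (hd j).ne'
      have := (hd i).ne'
      simp only [y]
      field_simp
    have h4 : g (y t) i a
        = Real.exp (c * t) * (w a / d i) * (doubleIntegratorA m).mulVec (e t i) a := by
      rcases a with k | k
      · simp only [g, y, w, Sum.elim_inl, Sum.elim_inr, doubleIntegratorA_mulVec_inl]
        ring
      · simp [g, doubleIntegratorA_mulVec_inr]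
    simp only [y', h3, h4, Pi.sub_apply, Finset.sum_apply, Pi.smul_apply, smul_eq_mul]
    simp only [y]
    ring
  have hbound : ∀ t, ‖y' t‖ ≤ (c - μ / 2) * ‖y t‖ := by
    intro t
    have hz : ∀ p, |y t p| ≤ ‖y t‖ := fun p => norm_le_pi_norm (y t) p
    have hn := norm_nonneg (y t)
    have hcoord : ∀ p, |y' t p| ≤ (c - μ / 2) * ‖y t‖ := by
      rintro ⟨i, a⟩
      have hdi := hd i
      have h1 : |g (y t) i a| ≤ μ / 2 * ‖y t‖ := by
        rcases a with k | k
        · simp only [g, Sum.elim_inl, abs_mul, abs_of_pos (half_pos hμ)]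
          gcongr
          exact hz _
        · simp only [g, Sum.elim_inr, abs_zero]
          positivity
      have h2 : |c * y t (i, a) - ∑ j, M i j * (d j / d i) * y t (j, a)|
          ≤ (c - μ) * ‖y t‖ := by
        have e1 : c * y t (i, a) - ∑ j, M i j * (d j / d i) * y t (j, a)
            = ∑ j, ((if i = j then c else 0) - M i j) * (d j / d i) * y t (j, a) := by
          simp only [sub_mul, Finset.sum_sub_distrib, ite_mul, zero_mul, Finset.sum_ite_eq,
            Finset.mem_univ, if_true, div_self hdi.ne', mul_one]
        have e2 : ∀ j, 0 ≤ ((if i = j then c else 0) - M i j) * (d j / d i) := by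
          intro j
          refine mul_nonneg ?_ (div_pos (hd j) hdi).le
          split_ifs with h
          · subst h
            exact sub_nonneg.2 (hc i)
          · linarith [hoff i j h]
        have e3 : ∑ j, ((if i = j then c else 0) - M i j) * (d j / d i)
            = c - (∑ j, M i j * d j) / d i := by
          simp only [sub_mul, Finset.sum_sub_distrib, ite_mul, zero_mul, Finset.sum_ite_eq,
            Finset.mem_univ, if_true, div_self hdi.ne', mul_one, Finset.sum_div, mul_div_assoc]
        have e4 : μ ≤ (∑ j, M i j * d j) / d i := (le_div_iff₀ hdi).2 (hM i)
        rw [e1]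
        calc |∑ j, ((if i = j then c else 0) - M i j) * (d j / d i) * y t (j, a)|
            ≤ ∑ j, |((if i = j then c else 0) - M i j) * (d j / d i) * y t (j, a)| :=
              Finset.abs_sum_le_sum_abs _ _
          _ ≤ ∑ j, ((if i = j then c else 0) - M i j) * (d j / d i) * ‖y t‖ := by
              refine Finset.sum_le_sum fun j _ => ?_
              rw [abs_mul, abs_of_nonneg (e2 j)]
              exact mul_le_mul_of_nonneg_left (hz _) (e2 j)
          _ = (c - (∑ j, M i j * d j) / d i) * ‖y t‖ := by rw [← Finset.sum_mul, e3]
          _ ≤ (c - μ) * ‖y t‖ := by gcongr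
      calc |y' t (i, a)|
          = |(c * y t (i, a) - ∑ j, M i j * (d j / d i) * y t (j, a)) + g (y t) i a| := by
            simp only [y']
            congr 1
            ring
        _ ≤ (c - μ) * ‖y t‖ + μ / 2 * ‖y t‖ := (abs_add_le _ _).trans (add_le_add h2 h1)
        _ = (c - μ / 2) * ‖y t‖ := by ring
    rcases isEmpty_or_nonempty (Fin N × (Fin m ⊕ Fin m)) with hE | ⟨⟨p⟩⟩
    · have h0 : y t = 0 := Subsingleton.elim _ _
      have h0' : y' t = 0 := Subsingleton.elim _ _
      rw [h0, h0']
      simp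
    · exact (pi_norm_le_iff_of_nonneg ((abs_nonneg _).trans (hcoord p))).2 hcoord
  have hgron : ∀ t, 0 ≤ t → ‖y t‖ ≤ ‖y 0‖ * Real.exp ((c - μ / 2) * t) := by
    intro t ht
    have := norm_le_gronwallBound_of_norm_deriv_right_le (f := y) (f' := y') (δ := ‖y 0‖)
      (K := c - μ / 2) (ε := 0) (a := 0) (b := t)
      (fun s hs => (hy s hs.1).continuousWithinAt.mono Set.Icc_subset_Ici_self)
      (fun s hs => (hy s hs.1).mono (Set.Ici_subset_Ici.2 hs.1)) le_rfl
      (fun s _ => by simpa using hbound s) t ⟨ht, le_rfl⟩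
    rwa [gronwallBound_ε0, sub_zero] at this
  refine ⟨∑ p : Fin N × (Fin m ⊕ Fin m), d p.1 / w p.2 * ‖y 0‖, Finset.sum_nonneg fun p _ =>
    mul_nonneg (div_pos (hd _) (hw _)).le (norm_nonneg _), fun t ht i a => ?_⟩
  have hdi := hd i
  have hwa := hw a
  have h1 : |e t i a| = d i / w a * (Real.exp (-(c * t)) * |y t (i, a)|) := by
    simp only [y, abs_mul, Real.abs_exp, abs_of_pos (div_pos hwa hdi), Real.exp_neg]
    have := Real.exp_pos (c * t)
    field_simp
  have h2 : |y t (i, a)| ≤ ‖y 0‖ * Real.exp ((c - μ / 2) * t) :=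
    (norm_le_pi_norm (y t) (i, a)).trans (hgron t ht)
  have h3 : Real.exp (-(c * t)) * Real.exp ((c - μ / 2) * t) = Real.exp (-(μ / 2) * t) := by
    rw [← Real.exp_add]
    congr 1
    ring
  have h4 : d i / w a * ‖y 0‖ ≤ ∑ p : Fin N × (Fin m ⊕ Fin m), d p.1 / w p.2 * ‖y 0‖ :=
    Finset.single_le_sum (f := fun p : Fin N × (Fin m ⊕ Fin m) => d p.1 / w p.2 * ‖y 0‖)
      (fun p _ => mul_nonneg (div_pos (hd _) (hw _)).le (norm_nonneg _)) (Finset.mem_univ (i, a))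
  calc |e t i a| ≤ d i / w a * (Real.exp (-(c * t)) * (‖y 0‖ * Real.exp ((c - μ / 2) * t))) := by
        rw [h1]
        gcongr
    _ = d i / w a * ‖y 0‖ * Real.exp (-(μ / 2) * t) := by rw [← h3]; ring
    _ ≤ _ := by gcongr

/-! ### The saturation function -/

lemma sat_eq_max_min (w : ℝ) : sat w = max (-1) (min 1 w) := by
  unfold sat
  rcases lt_trichotomy w 0 with h | rfl | h
  · rw [Real.sign_of_neg h, abs_of_neg h, min_eq_right (by linarith : w ≤ 1)]
    rcases le_total 1 (-w) with h1 | h1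
    · rw [min_eq_left h1, max_eq_left (by linarith)]
      ring
    · rw [min_eq_right h1, max_eq_right (by linarith)]
      ring
  · simp
  · rw [Real.sign_of_pos h, abs_of_pos h, one_mul, max_eq_right]
    exact (by norm_num : (-1 : ℝ) ≤ 0).trans (le_min zero_le_one h.le)

lemma abs_sat_sub_sat_le (a b : ℝ) : |sat a - sat b| ≤ |a - b| := by
  rw [sat_eq_max_min, sat_eq_max_min]
  refine (abs_max_sub_max_le_max _ _ _ _).trans (max_le (by simp) ?_)
  exact (abs_min_sub_min_le_max _ _ _ _).trans (max_le (by simp) le_rfl)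

lemma abs_sat_le_one (a : ℝ) : |sat a| ≤ 1 := by
  rw [sat_eq_max_min, abs_le]
  exact ⟨le_max_left _ _, max_le (by norm_num) (min_le_left _ _)⟩

lemma sat_neg (a : ℝ) : sat (-a) = -sat a := by
  rw [sat, sat, Real.sign_neg, abs_neg, neg_mul]

lemma sat_nonneg {a : ℝ} (h : 0 ≤ a) : 0 ≤ sat a := by
  rw [sat_eq_max_min]
  exact le_max_of_le_right (le_min zero_le_one h)

lemma sat_nonpos {a : ℝ} (h : a ≤ 0) : sat a ≤ 0 := by
  rw [sat_eq_max_min]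
  exact max_le (by norm_num) (min_le_of_right_le h)

lemma sat_eq_self_of_abs_lt {a : ℝ} (h : |sat a| < 1) : sat a = a := by
  rw [sat_eq_max_min] at h ⊢
  rcases le_total 1 a with h1 | h1
  · simp [min_eq_left h1] at h
  · rw [min_eq_right h1] at h ⊢
    rcases le_total a (-1) with h2 | h2
    · simp [max_eq_left h2] at h
    · exact max_eq_right h2

lemma continuous_sat : Continuous sat := by
  rw [show sat = fun w => max (-1) (min 1 w) from funext sat_eq_max_min]
  fun_prop

/-- The potential `∫₀ˢ sat` of the saturation function. -/
noncomputable def satPotential (s : ℝ) : ℝ := ∫ x in (0 : ℝ)..s, sat x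

lemma hasDerivAt_satPotential (s : ℝ) : HasDerivAt satPotential (sat s) s :=
  (continuous_sat.integral_hasStrictDerivAt 0 s).hasDerivAt

lemma satPotential_nonneg (s : ℝ) : 0 ≤ satPotential s := by
  unfold satPotential
  rcases le_total 0 s with h | h
  · exact intervalIntegral.integral_nonneg h fun u hu => sat_nonneg hu.1
  · rw [intervalIntegral.integral_symm, ← intervalIntegral.integral_neg]
    exact intervalIntegral.integral_nonneg h fun u hu => neg_nonneg.2 (sat_nonpos hu.2)

section satVec

variable {ι : Type} [Fintype ι]

lemma norm_satVec_sub_le (x y : ι → ℝ) : ‖satVec x - satVec y‖ ≤ ‖x - y‖ := by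
  refine (pi_norm_le_iff_of_nonneg (norm_nonneg _)).2 fun k => ?_
  exact (abs_sat_sub_sat_le (x k) (y k)).trans (norm_le_pi_norm (x - y) k)

lemma lipschitzWith_satVec : LipschitzWith 1 (satVec : (ι → ℝ) → ι → ℝ) :=
  LipschitzWith.of_dist_le_mul fun x y => by
    simpa [dist_eq_norm] using norm_satVec_sub_le x y

lemma norm_satVec_le_one (x : ι → ℝ) : ‖satVec x‖ ≤ 1 :=
  (pi_norm_le_iff_of_nonneg zero_le_one).2 fun k => abs_sat_le_one (x k)

lemma satVec_neg {κ : Type} (x : κ → ℝ) : satVec (-x) = -satVec x := funext fun k => sat_neg (x k)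

lemma satVec_eq_self_of_norm_lt {x : ι → ℝ} (h : ‖satVec x‖ < 1) : satVec x = x :=
  funext fun k => sat_eq_self_of_abs_lt ((norm_le_pi_norm (satVec x) k).trans_lt h)

end satVec

/-! ### Quadratic and bilinear forms in the supremum norm -/

section Forms

open scoped Matrix

variable {ι : Type} [Fintype ι]

lemma exists_posDef_lower_bound {P : Matrix ι ι ℝ} (hP : P.PosDef) :
    ∃ c : ℝ, 0 < c ∧ ∀ x : ι → ℝ, c * ‖x‖ ^ 2 ≤ x ⬝ᵥ P *ᵥ x := by
  have hcont : Continuous fun x : ι → ℝ => x ⬝ᵥ P *ᵥ x := by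
    simp only [dotProduct, Matrix.mulVec]
    fun_prop
  have hpos : ∀ x : ι → ℝ, x ≠ 0 → 0 < x ⬝ᵥ P *ᵥ x := fun x hx => by
    simpa using hP.dotProduct_mulVec_pos hx
  rcases (Metric.sphere (0 : ι → ℝ) 1).eq_empty_or_nonempty with h | h
  · refine ⟨1, one_pos, fun x => ?_⟩
    by_cases hx : x = 0
    · simp [hx]
    · exfalso
      have : ‖x‖⁻¹ • x ∈ Metric.sphere (0 : ι → ℝ) 1 := by
        simp [norm_smul, norm_ne_zero_iff.2 hx]
      simp [h] at this
  · obtain ⟨x₀, hx₀, hmin⟩ := (isCompact_sphere (0 : ι → ℝ) 1).exists_isMinOn h hcont.continuousOn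
    have hne : x₀ ≠ 0 := by
      rintro rfl
      simp at hx₀
    refine ⟨_, hpos x₀ hne, fun x => ?_⟩
    by_cases hx : x = 0
    · simp [hx]
    · have hn : ‖x‖ ≠ 0 := norm_ne_zero_iff.2 hx
      have hmem : ‖x‖⁻¹ • x ∈ Metric.sphere (0 : ι → ℝ) 1 := by
        simp [norm_smul, hn]
      have h1 : x₀ ⬝ᵥ P *ᵥ x₀ ≤ (‖x‖⁻¹ • x) ⬝ᵥ P *ᵥ (‖x‖⁻¹ • x) := hmin hmem
      rw [Matrix.mulVec_smul, smul_dotProduct, dotProduct_smul, smul_eq_mul, smul_eq_mul] at h1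
      calc (x₀ ⬝ᵥ P *ᵥ x₀) * ‖x‖ ^ 2
          ≤ (‖x‖⁻¹ * (‖x‖⁻¹ * (x ⬝ᵥ P *ᵥ x))) * ‖x‖ ^ 2 := by gcongr
        _ = x ⬝ᵥ P *ᵥ x := by field_simp

lemma exists_bilin_bound (A : Matrix ι ι ℝ) :
    ∃ C : ℝ, 0 ≤ C ∧ ∀ x y : ι → ℝ, |x ⬝ᵥ A *ᵥ y| ≤ C * ‖x‖ * ‖y‖ := by
  refine ⟨∑ i, ∑ j, |A i j|, by positivity, fun x y => ?_⟩
  simp only [dotProduct, Matrix.mulVec, Finset.mul_sum, Finset.sum_mul]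
  refine (Finset.abs_sum_le_sum_abs _ _).trans (Finset.sum_le_sum fun i _ => ?_)
  refine (Finset.abs_sum_le_sum_abs _ _).trans (Finset.sum_le_sum fun j _ => ?_)
  have h1 : |x i| ≤ ‖x‖ := norm_le_pi_norm x i
  have h2 : |y j| ≤ ‖y‖ := norm_le_pi_norm y j
  rw [abs_mul, abs_mul]
  calc |x i| * (|A i j| * |y j|) ≤ ‖x‖ * (|A i j| * ‖y‖) := by gcongr
    _ = |A i j| * ‖x‖ * ‖y‖ := by ring

lemma dotProduct_mulVec_comm_of_posDef {P : Matrix ι ι ℝ} (hP : P.PosDef) (x y : ι → ℝ) :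
    x ⬝ᵥ P *ᵥ y = y ⬝ᵥ P *ᵥ x := by
  have hT : Pᵀ = P := by simpa [Matrix.IsHermitian] using hP.isHermitian
  rw [Matrix.dotProduct_mulVec, dotProduct_comm, ← Matrix.mulVec_transpose, hT]

lemma hasDerivWithinAt_mulVec {κ : Type} [Fintype κ] (A : Matrix κ ι ℝ) {x : ℝ → ι → ℝ}
    {x' : ι → ℝ} {s : Set ℝ} {t : ℝ} (hx : HasDerivWithinAt x x' s t) :
    HasDerivWithinAt (fun r => A *ᵥ x r) (A *ᵥ x') s t := by
  rw [hasDerivWithinAt_pi] at hx ⊢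
  intro i
  exact HasDerivWithinAt.fun_sum fun j _ => (hx j).const_mul (A i j)

lemma hasDerivWithinAt_dotProduct {x y : ℝ → ι → ℝ} {x' y' : ι → ℝ} {s : Set ℝ} {t : ℝ}
    (hx : HasDerivWithinAt x x' s t) (hy : HasDerivWithinAt y y' s t) :
    HasDerivWithinAt (fun r => x r ⬝ᵥ y r) (x' ⬝ᵥ y t + x t ⬝ᵥ y') s t := by
  rw [hasDerivWithinAt_pi] at hx hy
  simp only [dotProduct, ← Finset.sum_add_distrib]
  exact HasDerivWithinAt.fun_sum fun j _ => (hx j).mul (hy j)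

end Forms

/-! ### Lyapunov arguments on the half-line -/

lemma antitoneOn_of_hasDerivWithinAt_Ici {D : Set ℝ} (hD : Convex ℝ D) (hsub : D ⊆ Set.Ici 0)
    {f f' : ℝ → ℝ} (hf : ∀ t ∈ D, HasDerivWithinAt f (f' t) (Set.Ici 0) t)
    (hf' : ∀ t ∈ D, f' t ≤ 0) : AntitoneOn f D :=
  antitoneOn_of_hasDerivWithinAt_nonpos hD (fun t ht => (hf t ht).continuousWithinAt.mono hsub)
    (fun t ht => (hf t (interior_subset ht)).mono (interior_subset.trans hsub))
    (fun t ht => hf' t (interior_subset ht))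

/-- A form of Barbalat's lemma: a Lipschitz function tends to zero if its square bounds the
dissipation of a nonnegative storage function. -/
theorem tendsto_zero_of_dissipation {Y Y' h : ℝ → ℝ} {q L : ℝ} (hq : 0 < q) (hL : 0 ≤ L)
    (hY : ∀ t, 0 ≤ t → HasDerivWithinAt Y (Y' t) (Set.Ici 0) t) (hY0 : ∀ t, 0 ≤ t → 0 ≤ Y t)
    (hdiss : ∀ t, 0 ≤ t → Y' t ≤ -(q * h t ^ 2)) (hh : ∀ t, 0 ≤ t → 0 ≤ h t)
    (hLip : ∀ s t, 0 ≤ s → s ≤ t → |h t - h s| ≤ L * (t - s)) :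
    Tendsto h atTop (𝓝 0) := by
  have hanti : AntitoneOn Y (Set.Ici 0) :=
    antitoneOn_of_hasDerivWithinAt_Ici (convex_Ici 0) subset_rfl hY fun t ht =>
      (hdiss t ht).trans (neg_nonpos.2 (by positivity))
  obtain ⟨l, hl⟩ : ∃ l, Tendsto (fun t => Y (max t 0)) atTop (𝓝 l) := by
    refine ⟨_, tendsto_atTop_ciInf (fun s t hst => hanti (Set.mem_Ici.2 (le_max_right _ _))
      (Set.mem_Ici.2 (le_max_right _ _))
      (max_le_max_right 0 hst)) ⟨0, ?_⟩⟩
    rintro _ ⟨t, rfl⟩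
    exact hY0 _ (le_max_right _ _)
  rw [Metric.tendsto_nhds]
  intro ε hε
  -- A value at least `ε` at time `t` forces a value at least `ε / 2` on `[t, t + δ]`.
  set δ : ℝ := ε / (2 * (L + 1)) with hδ
  have hδ0 : 0 < δ := by positivity
  have hLδ : L * δ ≤ ε / 2 := by
    have : (L + 1) * δ = ε / 2 := by rw [hδ]; field_simp
    nlinarith
  have hdiff : Tendsto (fun t => Y (max t 0) - Y (max (t + δ) 0)) atTop (𝓝 0) := by
    simpa using hl.sub (hl.comp (tendsto_atTop_add_const_right _ δ tendsto_id))
  have hη : 0 < q * (ε / 2) ^ 2 * δ := by positivity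
  filter_upwards [hdiff.eventually (gt_mem_nhds hη), eventually_ge_atTop 0] with t ht ht0
  rw [max_eq_left ht0, max_eq_left (by linarith : 0 ≤ t + δ)] at ht
  rw [Real.dist_eq, sub_zero, abs_of_nonneg (hh t ht0)]
  by_contra! hcon
  have hlow : ∀ s ∈ Set.Icc t (t + δ), ε / 2 ≤ h s := by
    intro s hs
    have h1 := (abs_le.1 (hLip t s ht0 hs.1)).1
    have h2 : L * (s - t) ≤ L * δ := mul_le_mul_of_nonneg_left (by linarith [hs.2]) hL
    linarith
  have hA : AntitoneOn (fun s => Y s + q * (ε / 2) ^ 2 * s) (Set.Icc t (t + δ)) := by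
    refine antitoneOn_of_hasDerivWithinAt_Ici (f' := fun s => Y' s + q * (ε / 2) ^ 2 * 1)
      (convex_Icc _ _) (fun s hs => ht0.trans hs.1)
      (fun s hs => (hY s (ht0.trans hs.1)).add ((hasDerivWithinAt_id s _).const_mul _)) ?_
    intro s hs
    have h1 := hdiss s (ht0.trans hs.1)
    have h2 : (ε / 2) ^ 2 ≤ h s ^ 2 := pow_le_pow_left₀ (by positivity) (hlow s hs) 2
    have h3 := mul_le_mul_of_nonneg_left h2 hq.le
    linarith
  have := hA ⟨le_rfl, by linarith⟩ ⟨by linarith, le_rfl⟩ (by linarith : t ≤ t + δ)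
  simp only at this
  linarith

/-- A nonnegative solution of `U' ≤ -a U + b` tends to zero if the input `b` does. -/
theorem tendsto_zero_of_deriv_le {U U' b : ℝ → ℝ} {a : ℝ} (ha : 0 < a)
    (hU : ∀ t, 0 ≤ t → HasDerivWithinAt U (U' t) (Set.Ici 0) t) (hU0 : ∀ t, 0 ≤ t → 0 ≤ U t)
    (hle : ∀ t, 0 ≤ t → U' t ≤ -(a * U t) + b t) (hb : Tendsto b atTop (𝓝 0)) :
    Tendsto U atTop (𝓝 0) := by
  rw [Metric.tendsto_nhds]
  intro ε hε
  have hη : 0 < a * (ε / 2) := by positivity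
  obtain ⟨T, hT⟩ := eventually_atTop.1 (hb.eventually (gt_mem_nhds hη))
  set T₀ := max T 0 with hT₀
  have hT0 : 0 ≤ T₀ := le_max_right _ _
  have hA : AntitoneOn (fun t => Real.exp (a * t) * (U t - ε / 2)) (Set.Ici T₀) := by
    refine antitoneOn_of_hasDerivWithinAt_Ici (f' := fun t =>
      Real.exp (a * t) * (a * 1) * (U t - ε / 2) + Real.exp (a * t) * U' t)
      (convex_Ici _) (Set.Ici_subset_Ici.2 hT0)
      (fun t ht => ((((hasDerivAt_id t).const_mul a).exp).hasDerivWithinAt).mul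
        ((hU t (hT0.trans ht)).sub_const _)) ?_
    intro t ht
    have h1 := hle t (hT0.trans ht)
    have h2 := hT t ((le_max_left _ _).trans ht)
    have h3 : Real.exp (a * t) * (a * 1) * (U t - ε / 2) + Real.exp (a * t) * U' t
        = Real.exp (a * t) * (a * (U t - ε / 2) + U' t) := by ring
    rw [h3]
    exact mul_nonpos_of_nonneg_of_nonpos (Real.exp_pos _).le (by linarith)
  set κ := Real.exp (a * T₀) * (U T₀ - ε / 2) with hκ
  have hexp : Tendsto (fun t => Real.exp (-(a * t)) * κ) atTop (𝓝 0) := by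
    have h1 : Tendsto (fun t => Real.exp (-(a * t))) atTop (𝓝 0) :=
      Real.tendsto_exp_neg_atTop_nhds_zero.comp (tendsto_id.const_mul_atTop ha)
    simpa using h1.mul_const κ
  filter_upwards [hexp.eventually (gt_mem_nhds (half_pos hε)), eventually_ge_atTop T₀] with t h1 h2
  rw [Real.dist_eq, sub_zero, abs_of_nonneg (hU0 t (hT0.trans h2))]
  have h3 : Real.exp (a * t) * (U t - ε / 2) ≤ κ := hA Set.self_mem_Ici h2 h2
  have h4 : U t - ε / 2 = Real.exp (-(a * t)) * (Real.exp (a * t) * (U t - ε / 2)) := by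
    rw [← mul_assoc, ← Real.exp_add]
    simp
  have h5 := mul_le_mul_of_nonneg_left h3 (Real.exp_pos (-(a * t))).le
  linarith

/-! ### The saturated double integrator with an exponentially decaying disturbance -/

section DoubleIntegrator

open scoped Matrix

variable {ι : Type} [Fintype ι] {P Q : Matrix ι ι ℝ} {p v w : ℝ → ι → ℝ} {M l : ℝ}

/-- Convergence of the feedback signal `P p + Q v`. The function `V = ∑ k, ∫ sat + v ⬝ P v / 2`
decreases along the undisturbed motion at the rate `s ⬝ Q s`, where `s` is the saturated signal, and
the disturbance enters its derivative at most with the factor `1 + V`. Multiplying `1 + V` by the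
exponential of the remaining integral of the disturbance bound therefore gives a function that
decreases along the disturbed motion. -/
theorem saturated_feedback_tendsto_zero (hP : P.PosDef) (hQ : Q.PosDef) (hl : 0 < l) (hM : 0 ≤ M)
    (hw : ∀ t, 0 ≤ t → ‖w t‖ ≤ M * Real.exp (-l * t))
    (hp : ∀ t, 0 ≤ t → HasDerivWithinAt p (v t) (Set.Ici 0) t)
    (hv : ∀ t, 0 ≤ t → HasDerivWithinAt v (-satVec (P *ᵥ p t + Q *ᵥ v t - w t)) (Set.Ici 0) t) :
    Tendsto (fun t => P *ᵥ p t + Q *ᵥ v t) atTop (𝓝 0) := by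
  obtain ⟨c, hc, hcP⟩ := exists_posDef_lower_bound hP
  obtain ⟨q, hq, hqQ⟩ := exists_posDef_lower_bound hQ
  obtain ⟨CP, hCP, hbP⟩ := exists_bilin_bound P
  obtain ⟨CQ, hCQ, hbQ⟩ := exists_bilin_bound Q
  set z : ℝ → ι → ℝ := fun t => P *ᵥ p t + Q *ᵥ v t with hz
  set s' : ℝ → ι → ℝ := fun t => satVec (z t - w t) with hs'
  have hv' : ∀ t, 0 ≤ t → HasDerivWithinAt v (-s' t) (Set.Ici 0) t := hv
  set z' : ℝ → ι → ℝ := fun t => P *ᵥ v t + Q *ᵥ (-s' t) with hz'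
  have hdz : ∀ t, 0 ≤ t → HasDerivWithinAt z (z' t) (Set.Ici 0) t := fun t ht =>
    (hasDerivWithinAt_mulVec P (hp t ht)).add (hasDerivWithinAt_mulVec Q (hv' t ht))
  set V : ℝ → ℝ := fun t => ∑ k, satPotential (z t k) + (v t ⬝ᵥ P *ᵥ v t) / 2 with hV
  set V' : ℝ → ℝ := fun t => satVec (z t) ⬝ᵥ z' t + v t ⬝ᵥ P *ᵥ (-s' t) with hV'
  have hdV : ∀ t, 0 ≤ t → HasDerivWithinAt V (V' t) (Set.Ici 0) t := by
    intro t ht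
    have h1 : HasDerivWithinAt (fun r => ∑ k, satPotential (z r k))
        (satVec (z t) ⬝ᵥ z' t) (Set.Ici 0) t :=
      HasDerivWithinAt.fun_sum fun k _ =>
        HasDerivAt.comp_hasDerivWithinAt (h₂ := satPotential) t (hasDerivAt_satPotential (z t k))
          (hasDerivWithinAt_pi.1 (hdz t ht) k)
    have h2 := (hasDerivWithinAt_dotProduct (hv' t ht)
      (hasDerivWithinAt_mulVec P (hv' t ht))).div_const 2
    refine (h1.add h2).congr_deriv ?_
    rw [dotProduct_mulVec_comm_of_posDef hP (-s' t) (v t)]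
    simp only [hV']
    ring
  have hvP : ∀ t, c * ‖v t‖ ^ 2 ≤ 2 * V t := by
    intro t
    have h1 : 0 ≤ ∑ k, satPotential (z t k) := Finset.sum_nonneg fun k _ => satPotential_nonneg _
    have h2 := hcP (v t)
    simp only [hV]
    linarith
  have hV0 : ∀ t, 0 ≤ V t := fun t => by
    have := hvP t
    have : 0 ≤ c * ‖v t‖ ^ 2 := by positivity
    linarith
  set κ : ℝ := M * (CQ + CP + CP * (2 / c)) with hκ
  have hκ0 : 0 ≤ κ := by positivity
  have hVle : ∀ t, 0 ≤ t → V' t ≤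
      -(q * ‖satVec (z t)‖ ^ 2) + κ * Real.exp (-l * t) * (1 + V t) := by
    intro t ht
    set E := Real.exp (-l * t) with hE
    have hE0 : 0 < E := Real.exp_pos _
    set D := satVec (z t) - s' t with hD
    have hDn : ‖D‖ ≤ M * E := by
      refine (norm_satVec_sub_le _ _).trans ?_
      rw [sub_sub_cancel]
      exact hw t ht
    have hs1 : ‖satVec (z t)‖ ≤ 1 := norm_satVec_le_one _
    have e1 : V' t = -(satVec (z t) ⬝ᵥ Q *ᵥ satVec (z t)) + satVec (z t) ⬝ᵥ Q *ᵥ D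
        + v t ⬝ᵥ P *ᵥ D := by
      have : s' t = satVec (z t) - D := by simp [hD]
      simp only [hV', hz', this, Matrix.mulVec_neg, Matrix.mulVec_sub, dotProduct_add,
        dotProduct_neg, dotProduct_sub]
      rw [dotProduct_mulVec_comm_of_posDef hP (satVec (z t)) (v t)]
      ring
    have h1 := hqQ (satVec (z t))
    have h2 : satVec (z t) ⬝ᵥ Q *ᵥ D ≤ CQ * (M * E) := by
      refine (le_abs_self _).trans ((hbQ _ _).trans ?_)
      calc CQ * ‖satVec (z t)‖ * ‖D‖ ≤ CQ * 1 * (M * E) := by gcongr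
        _ = CQ * (M * E) := by ring
    have hvV : ‖v t‖ ≤ 1 + 2 / c * V t := by
      have h3 : ‖v t‖ ^ 2 ≤ 2 / c * V t := by
        rw [div_mul_eq_mul_div, le_div_iff₀ hc]
        linarith [hvP t]
      nlinarith [sq_nonneg (‖v t‖ - 1)]
    have h3 : v t ⬝ᵥ P *ᵥ D ≤ CP * (1 + 2 / c * V t) * (M * E) := by
      refine (le_abs_self _).trans ((hbP _ _).trans ?_)
      have : 0 ≤ 1 + 2 / c * V t := (norm_nonneg _).trans hvV
      gcongr
    have h4 : CQ * (M * E) + CP * (1 + 2 / c * V t) * (M * E) ≤ κ * E * (1 + V t) := by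
      have h5 : κ * E * (1 + V t) - (CQ * (M * E) + CP * (1 + 2 / c * V t) * (M * E))
          = M * E * (CP * (2 / c) + (CQ + CP) * V t) := by
        rw [hκ]
        ring
      have h6 : 0 ≤ M * E * (CP * (2 / c) + (CQ + CP) * V t) := by
        have := hV0 t
        positivity
      linarith
    rw [e1]
    linarith
  -- `S t` is the integral of the disturbance bound `κ exp (-l r)` over `r ≥ t`.
  set S : ℝ → ℝ := fun t => κ / l * Real.exp (-l * t) with hS
  have hS0 : ∀ t, 0 ≤ S t := fun t => by positivity
  have hdS : ∀ t, HasDerivAt S (-(κ * Real.exp (-l * t))) t := by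
    intro t
    refine ((((hasDerivAt_id t).const_mul (-l)).exp).const_mul (κ / l)).congr_deriv ?_
    simp only [id]
    field_simp
  set Y : ℝ → ℝ := fun t => (1 + V t) * Real.exp (S t) with hY
  set Y' : ℝ → ℝ := fun t => V' t * Real.exp (S t)
    + (1 + V t) * (Real.exp (S t) * -(κ * Real.exp (-l * t))) with hY'
  have hdY : ∀ t, 0 ≤ t → HasDerivWithinAt Y (Y' t) (Set.Ici 0) t := fun t ht =>
    ((hdV t ht).const_add 1).mul (hdS t).exp.hasDerivWithinAt
  have hYdiss : ∀ t, 0 ≤ t → Y' t ≤ -(q * ‖satVec (z t)‖ ^ 2) := by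
    intro t ht
    have h1 : Y' t = Real.exp (S t) * (V' t - κ * Real.exp (-l * t) * (1 + V t)) := by
      simp only [hY']
      ring
    have h2 : 1 ≤ Real.exp (S t) := Real.one_le_exp (hS0 t)
    have h3 := hVle t ht
    have h4 : 0 ≤ q * ‖satVec (z t)‖ ^ 2 := by positivity
    rw [h1]
    calc Real.exp (S t) * (V' t - κ * Real.exp (-l * t) * (1 + V t))
        ≤ Real.exp (S t) * -(q * ‖satVec (z t)‖ ^ 2) := by
          gcongr
          linarith
      _ ≤ -(q * ‖satVec (z t)‖ ^ 2) := by nlinarith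
  have hY0 : ∀ t, 0 ≤ Y t := fun t => mul_nonneg (by linarith [hV0 t]) (Real.exp_pos _).le
  have hYle : ∀ t, 0 ≤ t → V t ≤ Y 0 := by
    intro t ht
    have h1 : Y t ≤ Y 0 := antitoneOn_of_hasDerivWithinAt_Ici (convex_Ici 0) subset_rfl hdY
      (fun t ht => (hYdiss t ht).trans (neg_nonpos.2 (by positivity))) Set.self_mem_Ici ht ht
    have h2 : 1 ≤ Real.exp (S t) := Real.one_le_exp (hS0 t)
    have h3 : 1 + V t ≤ Y t := le_mul_of_one_le_right (by linarith [hV0 t]) h2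
    linarith
  obtain ⟨Cv, hCv⟩ : ∃ C, ∀ t, 0 ≤ t → ‖v t‖ ≤ C := by
    refine ⟨1 + 2 * Y 0 / c, fun t ht => ?_⟩
    have h1 : ‖v t‖ ^ 2 ≤ 2 * Y 0 / c := by
      rw [le_div_iff₀ hc]
      linarith [hvP t, hYle t ht]
    nlinarith [sq_nonneg (‖v t‖ - 1)]
  -- The signal `z` has bounded derivative, because `v` and the saturated input are bounded.
  obtain ⟨L, hL0, hL⟩ : ∃ L, 0 ≤ L ∧ ∀ t, 0 ≤ t → ‖z' t‖ ≤ L := by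
    have hcont : Continuous fun x : (ι → ℝ) × (ι → ℝ) => P *ᵥ x.1 + Q *ᵥ x.2 := by
      fun_prop
    have hK := (isCompact_closedBall (0 : ι → ℝ) Cv).prod (isCompact_closedBall (0 : ι → ℝ) 1)
    obtain ⟨L, hL⟩ := hK.exists_bound_of_continuousOn hcont.continuousOn
    refine ⟨max L 0, le_max_right _ _, fun t ht => le_max_of_le_left (hL (v t, -s' t) ⟨?_, ?_⟩)⟩
    · simpa using hCv t ht
    · simpa using norm_satVec_le_one (z t - w t)
  have hs0 : Tendsto (fun t => ‖satVec (z t)‖) atTop (𝓝 0) := by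
    refine tendsto_zero_of_dissipation hq hL0 hdY (fun t _ => hY0 t) hYdiss
      (fun t _ => norm_nonneg _) fun a b ha hab => ?_
    have h1 : ‖z b - z a‖ ≤ L * ‖b - a‖ :=
      (convex_Ici (0 : ℝ)).norm_image_sub_le_of_norm_hasDerivWithin_le hdz hL ha (ha.trans hab)
    rw [Real.norm_of_nonneg (sub_nonneg.2 hab)] at h1
    exact (abs_norm_sub_norm_le _ _).trans ((norm_satVec_sub_le _ _).trans h1)
  refine tendsto_zero_iff_norm_tendsto_zero.2 (hs0.congr' ?_)
  filter_upwards [hs0.eventually (gt_mem_nhds one_pos)] with t ht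
  rw [satVec_eq_self_of_norm_lt ht]

/-- If `p' = v` and `P p + Q v` tends to zero, then so do `p` and `v`: the motion `Q p' = -P p`
is exponentially stable, with Lyapunov function `p ⬝ Q p`. -/
theorem tendsto_zero_of_combination (hP : P.PosDef) (hQ : Q.PosDef)
    (hp : ∀ t, 0 ≤ t → HasDerivWithinAt p (v t) (Set.Ici 0) t)
    (hz : Tendsto (fun t => P *ᵥ p t + Q *ᵥ v t) atTop (𝓝 0)) :
    Tendsto p atTop (𝓝 0) ∧ Tendsto v atTop (𝓝 0) := by
  classical
  obtain ⟨c, hc, hcP⟩ := exists_posDef_lower_bound hP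
  obtain ⟨q, hq, hqQ⟩ := exists_posDef_lower_bound hQ
  obtain ⟨C₁, hC₁, hb₁⟩ := exists_bilin_bound (1 : Matrix ι ι ℝ)
  obtain ⟨CQ, hCQ, hbQ⟩ := exists_bilin_bound Q
  set z : ℝ → ι → ℝ := fun t => P *ᵥ p t + Q *ᵥ v t with hzdef
  set U : ℝ → ℝ := fun t => p t ⬝ᵥ Q *ᵥ p t with hU
  have hUq : ∀ t, q * ‖p t‖ ^ 2 ≤ U t := fun t => hqQ (p t)
  have hdU : ∀ t, 0 ≤ t → HasDerivWithinAt U (2 * (p t ⬝ᵥ Q *ᵥ v t)) (Set.Ici 0) t := by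
    intro t ht
    refine (hasDerivWithinAt_dotProduct (hp t ht)
      (hasDerivWithinAt_mulVec Q (hp t ht))).congr_deriv ?_
    rw [dotProduct_mulVec_comm_of_posDef hQ (v t) (p t)]
    ring
  have hb : Tendsto (fun t => C₁ ^ 2 / c * ‖z t‖ ^ 2) atTop (𝓝 0) := by
    have := ((tendsto_zero_iff_norm_tendsto_zero.1 hz).pow 2).const_mul (C₁ ^ 2 / c)
    simpa using this
  have hU0 : Tendsto U atTop (𝓝 0) := by
    refine tendsto_zero_of_deriv_le (a := c / (CQ + 1)) (by positivity) hdU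
      (fun t _ => le_trans (by positivity) (hUq t)) (fun t _ => ?_) hb
    have e1 : p t ⬝ᵥ Q *ᵥ v t = p t ⬝ᵥ z t - p t ⬝ᵥ P *ᵥ p t := by
      simp [hzdef, dotProduct_add]
    have h1 := hcP (p t)
    have h2 : p t ⬝ᵥ z t ≤ C₁ * ‖p t‖ * ‖z t‖ := by
      have := (le_abs_self _).trans (hb₁ (p t) (z t))
      rwa [Matrix.one_mulVec] at this
    have h3 : U t ≤ (CQ + 1) * ‖p t‖ ^ 2 := by
      have h4 := (le_abs_self _).trans (hbQ (p t) (p t))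
      have : 0 ≤ ‖p t‖ ^ 2 := by positivity
      simp only [hU]
      nlinarith
    have h5 : c / (CQ + 1) * U t ≤ c * ‖p t‖ ^ 2 := by
      rw [div_mul_eq_mul_div, div_le_iff₀ (by positivity)]
      calc c * U t ≤ c * ((CQ + 1) * ‖p t‖ ^ 2) := by gcongr
        _ = c * ‖p t‖ ^ 2 * (CQ + 1) := by ring
    have h6 : 2 * (C₁ * ‖p t‖ * ‖z t‖) ≤ c * ‖p t‖ ^ 2 + C₁ ^ 2 / c * ‖z t‖ ^ 2 := by
      have h7 : c * ‖p t‖ ^ 2 + C₁ ^ 2 / c * ‖z t‖ ^ 2 - 2 * (C₁ * ‖p t‖ * ‖z t‖)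
          = (c * ‖p t‖ - C₁ * ‖z t‖) ^ 2 / c := by
        field_simp
        ring
      have h8 : 0 ≤ (c * ‖p t‖ - C₁ * ‖z t‖) ^ 2 / c := by positivity
      linarith
    rw [e1]
    linarith
  have hp0 : Tendsto p atTop (𝓝 0) := by
    have h1 : Tendsto (fun t => ‖p t‖ ^ 2) atTop (𝓝 0) := by
      refine squeeze_zero (fun t => by positivity) (fun t => ?_)
        (by simpa using hU0.const_mul q⁻¹)
      rw [← div_eq_inv_mul, le_div_iff₀ hq]
      linarith [hUq t]
    have h2 := h1.sqrt
    simp only [Real.sqrt_zero, Real.sqrt_sq (norm_nonneg _)] at h2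
    exact tendsto_zero_iff_norm_tendsto_zero.2 h2
  refine ⟨hp0, ?_⟩
  have hcont : Continuous fun x : (ι → ℝ) × (ι → ℝ) => Q⁻¹ *ᵥ (x.1 - P *ᵥ x.2) := by
    fun_prop
  have h1 := (hcont.tendsto (0, 0)).comp (hz.prodMk_nhds hp0)
  simp only [Matrix.mulVec_zero, sub_zero] at h1
  refine h1.congr fun t => ?_
  simp only [Function.comp, hzdef, add_sub_cancel_left, Matrix.mulVec_mulVec]
  rw [Matrix.nonsing_inv_mul _ ((Matrix.isUnit_iff_isUnit_det _).1 hQ.isUnit), Matrix.one_mulVec]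

end DoubleIntegrator

/-! ### Existence of closed-loop solutions -/

/-- `f` is globally Lipschitz with some constant. -/
def IsLipschitz {X Y : Type*} [PseudoEMetricSpace X] [PseudoEMetricSpace Y] (f : X → Y) : Prop :=
  ∃ K, LipschitzWith K f

namespace IsLipschitz

variable {X Y Z : Type*} [PseudoEMetricSpace X] [SeminormedAddCommGroup Y]
  [SeminormedAddCommGroup Z] {f g : X → Y}

lemma add (hf : IsLipschitz f) (hg : IsLipschitz g) : IsLipschitz fun x => f x + g x :=
  let ⟨_, hK⟩ := hf
  let ⟨_, hL⟩ := hg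
  ⟨_, hK.add hL⟩

lemma sub (hf : IsLipschitz f) (hg : IsLipschitz g) : IsLipschitz fun x => f x - g x :=
  let ⟨_, hK⟩ := hf
  let ⟨_, hL⟩ := hg
  ⟨_, hK.sub hL⟩

lemma pi {κ : Type*} [Fintype κ] {f : X → κ → Y} (hf : ∀ j, IsLipschitz fun x => f x j) :
    IsLipschitz f := by
  choose K hK using hf
  refine ⟨Finset.univ.sup K, fun x y => edist_pi_le_iff.2 fun j => ?_⟩
  refine (hK j x y).trans ?_
  gcongr
  exact Finset.le_sup (Finset.mem_univ j)

lemma prodMk {f : X → Y} {g : X → Z} (hf : IsLipschitz f) (hg : IsLipschitz g) :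
    IsLipschitz fun x => (f x, g x) :=
  let ⟨_, hK⟩ := hf
  let ⟨_, hL⟩ := hg
  ⟨_, hK.prodMk hL⟩

lemma sum {κ : Type*} (s : Finset κ) {f : κ → X → Y} (hf : ∀ j, IsLipschitz (f j)) :
    IsLipschitz fun x => ∑ j ∈ s, f j x := by
  classical
  induction s using Finset.induction_on with
  | empty => exact ⟨0, by simpa using LipschitzWith.const (0 : Y)⟩
  | insert a s ha ih =>
    simp only [Finset.sum_insert ha]
    exact (hf a).add ih

variable [NormedSpace ℝ Y] [NormedSpace ℝ Z]

lemma comp_continuousLinearMap (hf : IsLipschitz f) (T : Y →L[ℝ] Z) :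
    IsLipschitz fun x => T (f x) :=
  let ⟨_, hK⟩ := hf
  ⟨_, T.lipschitz.comp hK⟩

lemma const_smul (hf : IsLipschitz f) (a : ℝ) : IsLipschitz fun x => a • f x :=
  hf.comp_continuousLinearMap (a • ContinuousLinearMap.id ℝ Y)

lemma mulVec {ι κ : Type} [Fintype ι] [Fintype κ] (A : Matrix κ ι ℝ) {f : X → ι → ℝ}
    (hf : IsLipschitz f) : IsLipschitz fun x => A.mulVec (f x) :=
  hf.comp_continuousLinearMap (LinearMap.toContinuousLinearMap A.mulVecLin)

lemma satVec {ι : Type} [Fintype ι] {f : X → ι → ℝ} (hf : IsLipschitz f) :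
    IsLipschitz fun x => MAS.satVec (f x) :=
  let ⟨_, hK⟩ := hf
  ⟨_, lipschitzWith_satVec.comp hK⟩

lemma apply {κ : Type*} [Fintype κ] {f : X → κ → Y} (hf : IsLipschitz f) (j : κ) :
    IsLipschitz fun x => f x j :=
  hf.comp_continuousLinearMap (ContinuousLinearMap.proj (R := ℝ) (φ := fun _ : κ => Y) j)

lemma diffusive {N : ℕ} {ι : Type} [Fintype ι] (G : WeightedGraph N) {f : X → Fin N → ι → ℝ}
    (hf : IsLipschitz f) (i : Fin N) : IsLipschitz fun x => MAS.diffusive G (f x) i :=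
  sum _ fun j => ((hf.apply i).sub (hf.apply j)).const_smul _

end IsLipschitz

/-- The closed loop of any linear protocol is a globally Lipschitz autonomous equation, and hence
has a solution on `[0, ∞)` from every initial value. -/
theorem exists_isClosedLoopSolution {n m q c : Type} [Fintype n] [Fintype m] [Fintype q] [Fintype c]
    (A : Matrix n n ℝ) (B : Matrix n m ℝ) (C : Matrix q n ℝ) (P : LinearProtocol n m q c) {N : ℕ}
    (G : WeightedGraph N) (R : Finset (Fin N)) (xr₀ : n → ℝ) (x₀ : Fin N → n → ℝ)
    (xc₀ : Fin N → c → ℝ) :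
    ∃ xr x xc, IsClosedLoopSolution A B C P G R xr x xc ∧ xr 0 = xr₀ ∧ x 0 = x₀ ∧ xc 0 = xc₀ := by
  let X := (n → ℝ) × (Fin N → n → ℝ) × (Fin N → c → ℝ)
  have h1 : IsLipschitz fun z : X => z.1 := ⟨_, LipschitzWith.prod_fst⟩
  have h2 : IsLipschitz fun z : X => z.2.1 := ⟨_, LipschitzWith.prod_fst.comp LipschitzWith.prod_snd⟩
  have h3 : IsLipschitz fun z : X => z.2.2 := ⟨_, LipschitzWith.prod_snd.comp LipschitzWith.prod_snd⟩
  have hσ : ∀ i, IsLipschitz fun z : X => satVec (P.Fc.mulVec (z.2.2 i)) := fun i =>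
    ((h3.apply i).mulVec _).satVec
  let f : X → X := fun z => (A.mulVec z.1,
    fun i => A.mulVec (z.2.1 i) + B.mulVec (satVec (P.Fc.mulVec (z.2.2 i))),
    fun i => (P.Ac (iota R i)).mulVec (z.2.2 i)
        + P.Bc.mulVec (satVec (P.Fc.mulVec (z.2.2 i)))
        + P.Cc.mulVec (networkExchange G R (fun j => C.mulVec (z.2.1 j)) (C.mulVec z.1) i)
        + P.Dc.mulVec (diffusive G (fun j => P.Hc.mulVec (z.2.2 j)) i))
  have hf : IsLipschitz f := by
    refine (h1.mulVec A).prodMk (IsLipschitz.prodMk (IsLipschitz.pi fun i => ?_)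
      (IsLipschitz.pi fun i => ?_))
    · exact ((h2.apply i).mulVec A).add ((hσ i).mulVec B)
    · have hy : IsLipschitz fun (z : X) (j : Fin N) => C.mulVec (z.2.1 j) :=
        IsLipschitz.pi fun j => (h2.apply j).mulVec C
      have hξ : IsLipschitz fun (z : X) (j : Fin N) => P.Hc.mulVec (z.2.2 j) :=
        IsLipschitz.pi fun j => (h3.apply j).mulVec P.Hc
      have hζ : IsLipschitz fun z : X =>
          networkExchange G R (fun j => C.mulVec (z.2.1 j)) (C.mulVec z.1) i :=
        (hy.diffusive G i).add (((hy.apply i).sub (h1.mulVec C)).const_smul (iota R i))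
      exact ((((h3.apply i).mulVec _).add ((hσ i).mulVec _)).add (hζ.mulVec _)).add
        ((hξ.diffusive G i).mulVec _)
  obtain ⟨K, hK⟩ := hf
  obtain ⟨γ, h0, hγ⟩ := exists_global_solution hK (xr₀, x₀, xc₀)
  have hγ2 : ∀ t, 0 ≤ t → HasDerivWithinAt (fun s => (γ s).2) (f (γ t)).2 (Set.Ici 0) t :=
    fun t ht => (hγ t ht).snd
  refine ⟨fun t => (γ t).1, fun t => (γ t).2.1, fun t => (γ t).2.2,
    ⟨fun t ht => (hγ t ht).fst, fun i t ht => ?_, fun i t ht => ?_⟩, by simp [h0], by simp [h0],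
    by simp [h0]⟩
  · exact hasDerivWithinAt_pi.1 (hγ2 t ht).fst i
  · exact hasDerivWithinAt_pi.1 (hγ2 t ht).snd i

/-! ### Synchronization -/

section Synchronization

variable {m N : ℕ} {G : WeightedGraph N} {R : Finset (Fin N)} {K₁ K₂ : Matrix (Fin m) (Fin m) ℝ}
  {ρ : ℝ} {xr : ℝ → Fin m ⊕ Fin m → ℝ} {x χ : ℝ → Fin N → Fin m ⊕ Fin m → ℝ}

/-- The saturated inputs cancel in the estimation errors `x_i - x_r - χ_i`, which therefore obey a
linear equation governed by the expanded Laplacian. -/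
lemma hasDerivWithinAt_estimationError {K : Matrix (Fin m) (Fin m ⊕ Fin m) ℝ}
    (h : IsClosedLoopSolution (doubleIntegratorA m) (doubleIntegratorB m) 1
      (fullStateProtocol (doubleIntegratorA m) (doubleIntegratorB m) K ρ) G R xr x χ)
    (i : Fin N) (t : ℝ) (ht : 0 ≤ t) :
    HasDerivWithinAt (fun s => x s i - xr s - χ s i)
      ((doubleIntegratorA m).mulVec (x t i - xr t - χ t i)
        - ∑ j, expandedLaplacian G R i j • (x t j - xr t - χ t j)) (Set.Ici 0) t := by
  obtain ⟨h1, h2, h3⟩ := (isClosedLoopSolution_fullStateProtocol_iff _ _ _ _ _ _ _ _ _).1 h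
  refine (((h2 i t ht).sub (h1 t ht)).sub (h3 i t ht)).congr_deriv ?_
  have e1 : diffusive G (χ t) i + iota R i • χ t i
      = ∑ j, expandedLaplacian G R i j • χ t j := by
    simpa [networkExchange] using networkExchange_eq G R (χ t) 0 i
  have e2 : ∑ j, expandedLaplacian G R i j • (x t j - xr t - χ t j)
      = networkExchange G R (x t) (xr t) i - (diffusive G (χ t) i + iota R i • χ t i) := by
    rw [e1, networkExchange_eq, ← Finset.sum_sub_distrib]
    simp only [smul_sub]
  rw [e2, Matrix.mulVec_sub, Matrix.mulVec_sub]
  abel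

lemma doubleIntegratorB_mulVec_inl (u : Fin m → ℝ) (k : Fin m) :
    (doubleIntegratorB m).mulVec u (Sum.inl k) = 0 := by
  simp [doubleIntegratorB, Matrix.mulVec, dotProduct]

lemma doubleIntegratorB_mulVec_inr (u : Fin m → ℝ) (k : Fin m) :
    (doubleIntegratorB m).mulVec u (Sum.inr k) = u k := by
  simp [doubleIntegratorB, Matrix.mulVec, dotProduct, Matrix.one_apply]

lemma exists_norm_mulVec_le {ι : Type} [Fintype ι] (A : Matrix ι ι ℝ) :
    ∃ C : ℝ, 0 ≤ C ∧ ∀ y : ι → ℝ, ‖A.mulVec y‖ ≤ C * ‖y‖ :=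
  ⟨_, norm_nonneg _, (LinearMap.toContinuousLinearMap A.mulVecLin).le_opNorm⟩

/-- Each agent, relative to the exosystem, is a saturated double integrator driven by its own state
feedback up to an exponentially decaying disturbance, which is linear in the estimation error. -/
theorem regulatedStateSync_fullStateProtocol (hG : G.InClass R) (hρ : 0 < ρ)
    (hK₁ : (-K₁).PosDef) (hK₂ : (-K₂).PosDef)
    (h : IsClosedLoopSolution (doubleIntegratorA m) (doubleIntegratorB m) 1
      (fullStateProtocol (doubleIntegratorA m) (doubleIntegratorB m) (Matrix.fromCols K₁ K₂) ρ)
      G R xr x χ) : RegulatedStateSync xr x := by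
  suffices hreg : ∀ i, Tendsto (fun t => x t i - xr t) atTop (𝓝 0) by
    refine ⟨hreg, fun i j => ?_⟩
    simpa using (hreg i).sub (hreg j)
  intro i
  obtain ⟨d, μ, hμ, hd, hM⟩ := exists_pos_expandedLaplacian hG
  obtain ⟨C, hC, hdecay⟩ := exists_exp_decay (e := fun t j => x t j - xr t - χ t j)
    (fun i j => expandedLaplacian_offDiag_nonpos G R) hd hμ hM (hasDerivWithinAt_estimationError h)
  obtain ⟨h1, h2, -⟩ := (isClosedLoopSolution_fullStateProtocol_iff _ _ _ _ _ _ _ _ _).1 h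
  have hdx : ∀ t, 0 ≤ t → HasDerivWithinAt (fun s => x s i - xr s)
      ((doubleIntegratorA m).mulVec (x t i - xr t) + (doubleIntegratorB m).mulVec
        (satVec (ρ • (Matrix.fromCols K₁ K₂).mulVec (χ t i)))) (Set.Ici 0) t := by
    intro t ht
    refine ((h2 i t ht).sub (h1 t ht)).congr_deriv ?_
    rw [Matrix.mulVec_sub]
    abel
  set P : Matrix (Fin m) (Fin m) ℝ := ρ • -K₁ with hPdef
  set Q : Matrix (Fin m) (Fin m) ℝ := ρ • -K₂ with hQdef
  have hP : P.PosDef := hK₁.smul hρ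
  have hQ : Q.PosDef := hK₂.smul hρ
  set p : ℝ → Fin m → ℝ := fun t k => (x t i - xr t) (Sum.inl k) with hp
  set v : ℝ → Fin m → ℝ := fun t k => (x t i - xr t) (Sum.inr k) with hv
  set ep : ℝ → Fin m → ℝ := fun t k => (x t i - xr t - χ t i) (Sum.inl k) with hep
  set ev : ℝ → Fin m → ℝ := fun t k => (x t i - xr t - χ t i) (Sum.inr k) with hev
  have hinput : ∀ t, ρ • (Matrix.fromCols K₁ K₂).mulVec (χ t i)
      = -(P.mulVec (p t) + Q.mulVec (v t) - (P.mulVec (ep t) + Q.mulVec (ev t))) := by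
    intro t
    have e1 : χ t i = Sum.elim (p t - ep t) (v t - ev t) := by
      funext a
      rcases a with k | k <;> simp [hp, hv, hep, hev]
    rw [e1, Matrix.fromCols_mulVec_sumElim]
    simp only [hPdef, hQdef, Matrix.smul_mulVec, Matrix.neg_mulVec, Matrix.mulVec_sub, smul_add,
      smul_sub, smul_neg]
    abel
  have hdp : ∀ t, 0 ≤ t → HasDerivWithinAt p (v t) (Set.Ici 0) t := by
    intro t ht
    refine hasDerivWithinAt_pi.2 fun k => ?_
    refine (hasDerivWithinAt_pi.1 (hdx t ht) (Sum.inl k)).congr_deriv ?_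
    rw [Pi.add_apply, doubleIntegratorA_mulVec_inl, doubleIntegratorB_mulVec_inl, add_zero]
  have hdv : ∀ t, 0 ≤ t → HasDerivWithinAt v (-satVec (P.mulVec (p t) + Q.mulVec (v t)
      - (P.mulVec (ep t) + Q.mulVec (ev t)))) (Set.Ici 0) t := by
    intro t ht
    refine hasDerivWithinAt_pi.2 fun k => ?_
    refine (hasDerivWithinAt_pi.1 (hdx t ht) (Sum.inr k)).congr_deriv ?_
    rw [Pi.add_apply, doubleIntegratorA_mulVec_inr, doubleIntegratorB_mulVec_inr, zero_add,
      hinput, satVec_neg]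
  obtain ⟨CP, hCP, hbP⟩ := exists_norm_mulVec_le P
  obtain ⟨CQ, hCQ, hbQ⟩ := exists_norm_mulVec_le Q
  have hw : ∀ t, 0 ≤ t → ‖P.mulVec (ep t) + Q.mulVec (ev t)‖
      ≤ (CP * C + CQ * C) * Real.exp (-(μ / 2) * t) := by
    intro t ht
    have hE : 0 ≤ C * Real.exp (-(μ / 2) * t) := by positivity
    have h3 : ‖ep t‖ ≤ C * Real.exp (-(μ / 2) * t) :=
      (pi_norm_le_iff_of_nonneg hE).2 fun k => hdecay t ht i (Sum.inl k)
    have h4 : ‖ev t‖ ≤ C * Real.exp (-(μ / 2) * t) :=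
      (pi_norm_le_iff_of_nonneg hE).2 fun k => hdecay t ht i (Sum.inr k)
    calc ‖P.mulVec (ep t) + Q.mulVec (ev t)‖ ≤ CP * ‖ep t‖ + CQ * ‖ev t‖ :=
          (norm_add_le _ _).trans (add_le_add (hbP _) (hbQ _))
      _ ≤ CP * (C * Real.exp (-(μ / 2) * t)) + CQ * (C * Real.exp (-(μ / 2) * t)) := by gcongr
      _ = _ := by ring
  have hz := saturated_feedback_tendsto_zero hP hQ (half_pos hμ) (by positivity) hw hdp hdv
  obtain ⟨hp0, hv0⟩ := tendsto_zero_of_combination hP hQ hdp hz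
  refine tendsto_pi_nhds.2 fun a => ?_
  rcases a with k | k
  · exact tendsto_pi_nhds.1 hp0 k
  · exact tendsto_pi_nhds.1 hv0 k

theorem solvesScalableSync_fullStateProtocol (hρ : 0 < ρ) (hK₁ : (-K₁).PosDef)
    (hK₂ : (-K₂).PosDef) :
    SolvesScalableSync (doubleIntegratorA m) (doubleIntegratorB m)
      (1 : Matrix (Fin m ⊕ Fin m) (Fin m ⊕ Fin m) ℝ)
      (fullStateProtocol (doubleIntegratorA m) (doubleIntegratorB m)
        (Matrix.fromCols K₁ K₂) ρ) := by
  intro N R _ G hG xr₀ x₀ xc₀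
  exact ⟨exists_isClosedLoopSolution _ _ _ _ G R xr₀ x₀ xc₀,
    fun xr x xc h _ _ _ => regulatedStateSync_fullStateProtocol hG hρ hK₁ hK₂ h⟩

end Synchronization

end MAS

theorem mainTheorem4 (m : ℕ) :
    MAS.ScalableSyncSolvable (MAS.doubleIntegratorA m) (MAS.doubleIntegratorB m)
        (1 : Matrix (Fin m ⊕ Fin m) (Fin m ⊕ Fin m) ℝ) ∧
      ∀ (ρ : ℝ), 0 < ρ →
        ∀ K₁ K₂ : Matrix (Fin m) (Fin m) ℝ, (-K₁).PosDef → (-K₂).PosDef →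
          MAS.SolvesScalableSync (MAS.doubleIntegratorA m) (MAS.doubleIntegratorB m)
            (1 : Matrix (Fin m ⊕ Fin m) (Fin m ⊕ Fin m) ℝ)
            (MAS.fullStateProtocol (MAS.doubleIntegratorA m) (MAS.doubleIntegratorB m)
              (Matrix.fromCols K₁ K₂) ρ) := by
  have h1 : (-(-1 : Matrix (Fin m) (Fin m) ℝ)).PosDef := by
    rw [neg_neg]
    exact Matrix.PosDef.one
  exact ⟨⟨_, inferInstance, _, MAS.solvesScalableSync_fullStateProtocol one_pos h1 h1⟩,
    fun ρ hρ K₁ K₂ hK₁ hK₂ => MAS.solvesScalableSync_fullStateProtocol hρ hK₁ hK₂⟩
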